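/- **Setting.** Let $\mathcal X$ be a data universe (a measurable space in which points are measurable). A (multi-message) *shuffle protocol* $\Pi$ consists, for every intended number $n$ of users, of public randomness $W$, a randomizer $\Pi_R$ and an analyzer $\Pi_A$; both may depend on $n$ and see $W$. On data $x_1,\dots,x_k\in\mathcal X$, each of $k$ users independently applies $\Pi_R$ to their own datum and to $W$ to produce a vector of messages of arbitrary length; the shuffler $\Pi_S$ applies a uniformly random permutation to the concatenation of all messages. Write $\mathrm{View}_{n,k}(x_1,\dots,x_k)$ for $W$ together with the output of the shuffler. The honest execution is $\Pi(x_1,\dots,x_n)=\Pi_A(\mathrm{View}_{n,n}(x_1,\dots,x_n))$. $\Pi$ is *$(\varepsilon,\delta,\gamma)$-robustly shuffle private* if for all $n$ and all integers $k$ with $\gamma n\le k\le n$, the algorithm $\mathrm{View}_{n,k}$ is $(\varepsilon,\delta)$-differentially private: for all $\vec x,\vec x\,'\in\mathcal X^k$ that differ in at most one entry and all events $C$, $\Pr[\mathrm{View}_{n,k}(\vec x)\in C]\le e^{\varepsilon}\Pr[\mathrm{View}_{n,k}(\vec x\,')\in C]+\delta$. Let $d\ge 2$ and $\alpha\in(0,1/2)$.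 A method *solves $d$-wise simple hypothesis testing over $\mathcal X$ with error $\alpha$ and sample complexity $n$* in the shuffle model if it assigns to every (known) list $\mathcal Q=(Q_1,\dots,Q_d)$ of probability distributions on $\mathcal X$ with $d_{\mathrm{TV}}(Q_i,Q_j)\ge\alpha$ for all $i\ne j$ a shuffle protocol $\Pi^{\mathcal Q}$ such that for every $i$, on $n$ independent samples from $Q_i$, $\Pi^{\mathcal Q}$ outputs $i$ with probability at least $99/100$, over the samples and the coins of the protocol. **Theorem.** There are absolute constants $c,C>0$ such that the following holds. Let $d\ge 2$ be an integer, let $\mathcal X$ have at least $2^{\lfloor d/2\rfloor}$ elements (it may be infinite), let $\alpha\in(0,1/2)$, $\varepsilon>0$ and $\delta\in[0,1]$ with $$\delta\log\frac d\delta\ \le\ c\,\frac{\alpha^2\varepsilon^2}{d}$$ (the left side is read as $0$ if $\delta=0$). If a method solves $d$-wise simple hypothesis testing over $\mathcal X$ with error $\alpha$ and sample complexity $n$, and all its protocols $\Pi^{\mathcal Q}$ are $(\varepsilon,\delta,1/3)$-robustly shuffle private, then $$n\ \ge\ C\,\frac{\sqrt d}{\alpha\,\varepsilon}.$$ -/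

import Mathlib

open MeasureTheory ProbabilityTheory
open scoped ENNReal

universe u v w z

/-! ## Total variation distance and differential privacy -/

/-- The total variation distance `sup_A |μ(A) - ν(A)|` (over measurable events `A`) between two
probability measures. -/
noncomputable def tvDist {X : Type u} [MeasurableSpace X] (μ ν : Measure X) : ℝ :=
  ⨆ A : {A : Set X // MeasurableSet A}, |μ.real A.1 - ν.real A.1|

/-- Two datasets of `k` rows are neighbors if they differ in at most one row. -/
def Neighbors {X : Type u} {k : ℕ} (x y : Fin k → X) : Prop :=
  {i | x i ≠ y i}.Subsingleton

/-- `(ε, δ)`-differential privacy of a randomized algorithm `M`, where `M x` is the law of the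
output on the dataset `x`. -/
def IsDP {X : Type u} {R : Type v} [MeasurableSpace R] {k : ℕ} (ε δ : ℝ)
    (M : (Fin k → X) → Measure R) : Prop :=
  ∀ x y : Fin k → X, Neighbors x y → ∀ C : Set R, MeasurableSet C →
    M x C ≤ ENNReal.ofReal (Real.exp ε) * M y C + ENNReal.ofReal δ

/-! ## Words of messages -/

/-- `Y^*`: vectors of messages of arbitrary length, with the usual σ-algebra (disjoint union of
the product σ-algebras). -/
abbrev Word (Y : Type u) : Type u := Σ m : ℕ, (Fin m → Y)

namespace Word

variable {Y : Type u}

/-- A vector as a word. -/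
def mk (m : ℕ) (a : Fin m → Y) : Word Y := ⟨m, a⟩

/-- The empty word. -/
def nil : Word Y := ⟨0, Fin.elim0⟩

/-- Concatenation of words. -/
def append (p : Word Y × Word Y) : Word Y := ⟨p.1.1 + p.2.1, Fin.append p.1.2 p.2.2⟩

/-- The word whose letters are rearranged by the permutation `σ` of its positions. -/
def permute (a : Word Y) (σ : Equiv.Perm (Fin a.1)) : Word Y := ⟨a.1, a.2 ∘ σ⟩

theorem measurableSet_iff [MeasurableSpace Y] {s : Set (Word Y)} :
    MeasurableSet s ↔ ∀ m, MeasurableSet (mk m ⁻¹' s : Set (Fin m → Y)) := by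
  change MeasurableSet[⨅ m, _] s ↔ _
  rw [MeasurableSpace.measurableSet_iInf]
  rfl

theorem measurable_mk [MeasurableSpace Y] (m : ℕ) :
    Measurable (mk m : (Fin m → Y) → Word Y) :=
  fun _ hs => measurableSet_iff.1 hs m

theorem measurable_of_mk [MeasurableSpace Y] {Z : Type v} [MeasurableSpace Z] {f : Word Y → Z}
    (h : ∀ m, Measurable fun a : Fin m → Y => f ⟨m, a⟩) : Measurable f :=
  fun _ hs => measurableSet_iff.2 fun m => h m hs

theorem mk_injective (m : ℕ) : Function.Injective (mk m : (Fin m → Y) → Word Y) :=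
  fun _ _ h => eq_of_heq (Sigma.mk.inj h).2

theorem measurableEmbedding_mk [MeasurableSpace Y] (m : ℕ) :
    MeasurableEmbedding (mk m : (Fin m → Y) → Word Y) := by
  refine ⟨mk_injective m, measurable_mk m, fun {s} hs => measurableSet_iff.2 fun k => ?_⟩
  by_cases h : m = k
  · subst h
    rwa [Set.preimage_image_eq _ (mk_injective m)]
  · convert MeasurableSet.empty
    ext a
    simp only [Set.mem_preimage, Set.mem_image, Set.mem_empty_iff_false, iff_false]
    rintro ⟨b, -, hb⟩
    exact h (congrArg Sigma.fst hb)

theorem measurable_append [MeasurableSpace Y] :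
    Measurable (append : Word Y × Word Y → Word Y) := by
  intro s hs
  have key : append ⁻¹' s = ⋃ m : ℕ, ⋃ k : ℕ,
      Prod.map (mk m : (Fin m → Y) → Word Y) (mk k : (Fin k → Y) → Word Y) ''
        {q | (⟨m + k, Fin.append q.1 q.2⟩ : Word Y) ∈ s} := by
    ext p
    obtain ⟨⟨m, a⟩, ⟨k, b⟩⟩ := p
    simp only [Set.mem_preimage, Set.mem_iUnion, Set.mem_image, Set.mem_ofPred_eq]
    constructor
    · intro h
      exact ⟨m, k, (a, b), h, rfl⟩
    · rintro ⟨m', k', ⟨a', b'⟩, h, he⟩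
      rw [← he]
      exact h
  rw [key]
  refine MeasurableSet.iUnion fun m => MeasurableSet.iUnion fun k => ?_
  refine ((measurableEmbedding_mk m).prodMap (measurableEmbedding_mk k)).measurableSet_image.2 ?_
  have hm : Measurable fun q : (Fin m → Y) × (Fin k → Y) =>
      (⟨m + k, Fin.append q.1 q.2⟩ : Word Y) := by
    refine (measurable_mk (m + k)).comp (measurable_pi_iff.2 fun i => ?_)
    induction i using Fin.addCases with
    | left i => simp only [Fin.append_left]; fun_prop
    | right i => simp only [Fin.append_right]; fun_prop
  exact hm hs

end Word

/-! ## The shuffler and the users' messages -/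

/-- The shuffler: it applies a uniformly random permutation to the letters of a word. -/
noncomputable def shuffler (Y : Type u) [MeasurableSpace Y] : Kernel (Word Y) (Word Y) where
  toFun a := ((a.1.factorial : ℕ) : ℝ≥0∞)⁻¹ •
    ∑ σ : Equiv.Perm (Fin a.1), Measure.dirac (a.permute σ)
  measurable' := by
    refine Word.measurable_of_mk fun m => Measure.measurable_of_measurable_coe _ fun s hs => ?_
    have h : ∀ σ : Equiv.Perm (Fin m), Measurable fun a : Fin m → Y =>
        (Measure.dirac (Word.permute ⟨m, a⟩ σ) : Measure (Word Y)) s := fun σ =>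
      (Measure.measurable_coe hs).comp (Measure.measurable_dirac.comp
        ((Word.measurable_mk m).comp (measurable_pi_iff.2 fun i => measurable_pi_apply (σ i))))
    have h' : Measurable fun a : Fin m → Y => ((m.factorial : ℕ) : ℝ≥0∞)⁻¹ *
        ∑ σ : Equiv.Perm (Fin m), (Measure.dirac (Word.permute ⟨m, a⟩ σ) : Measure (Word Y)) s :=
      (Finset.measurable_fun_sum _ fun σ _ => h σ).const_mul _
    convert h' using 2 with a
    simp only [Measure.smul_apply, Measure.finsetSum_apply, smul_eq_mul]

/-- The concatenation of the messages of `k` users with data `x : Fin k → X`, who see the same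
public coins `ω` and independently apply the randomizer `R` to their own data. -/
noncomputable def userMessages {Ω : Type w} {X : Type u} {Y : Type z} [MeasurableSpace Ω]
    [MeasurableSpace X] [MeasurableSpace Y] (R : Kernel (Ω × X) (Word Y)) :
    (k : ℕ) → Kernel (Ω × (Fin k → X)) (Word Y)
  | 0 => Kernel.const _ (Measure.dirac Word.nil)
  | k + 1 =>
    ((R.comap (fun p : Ω × (Fin (k + 1) → X) => (p.1, p.2 0)) (by fun_prop)) ×ₖ
      ((userMessages R k).comap
        (fun p : Ω × (Fin (k + 1) → X) => (p.1, fun i : Fin k => p.2 i.succ))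
        (by fun_prop))).map Word.append

/-! ## Shuffle protocols -/

/-- A (multi-message) protocol in the shuffle model with data universe `X` and output space `O`.
Users and analyzer know the intended number `n` of users, and they have access to public coins. -/
structure ShuffleProtocol (X : Type u) (O : Type v) [MeasurableSpace X] [MeasurableSpace O] where
  /-- The space of the public randomness. -/
  Coins : Type w
  /-- The space of messages. -/
  Msg : Type z
  [measurableSpaceCoins : MeasurableSpace Coins]
  [measurableSpaceMsg : MeasurableSpace Msg]
  /-- The law of the public randomness. -/
  coinLaw : ℕ → Measure Coins
  [isProbabilityMeasure_coinLaw : ∀ n, IsProbabilityMeasure (coinLaw n)]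
  /-- The randomizer, from public coins and one user's data to a word of messages. -/
  randomizer : ℕ → Kernel (Coins × X) (Word Msg)
  [isMarkovKernel_randomizer : ∀ n, IsMarkovKernel (randomizer n)]
  /-- The analyzer, from public coins and the shuffled messages to the output. -/
  analyzer : ℕ → Kernel (Coins × Word Msg) O
  [isMarkovKernel_analyzer : ∀ n, IsMarkovKernel (analyzer n)]

attribute [instance] ShuffleProtocol.measurableSpaceCoins ShuffleProtocol.measurableSpaceMsg
  ShuffleProtocol.isProbabilityMeasure_coinLaw ShuffleProtocol.isMarkovKernel_randomizer
  ShuffleProtocol.isMarkovKernel_analyzer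

namespace ShuffleProtocol

variable {X : Type u} {O : Type v} [MeasurableSpace X] [MeasurableSpace O]

/-- What is publicly visible when the protocol is intended for `n` users and exactly `k` users,
with data `x : Fin k → X`, follow it (the others send nothing): the public coins together with
the output of the shuffler on the messages of these `k` users. -/
noncomputable def view (P : ShuffleProtocol.{u, v, w, z} X O) (n k : ℕ) :
    Kernel (Fin k → X) (P.Coins × Word P.Msg) :=
  Kernel.const _ (P.coinLaw n) ⊗ₖ
    ((shuffler P.Msg ∘ₖ userMessages (P.randomizer n) k).comap Prod.swap measurable_swap)

/-- The honest execution of the protocol on `n` users: the analyzer's output. -/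
noncomputable def exec (P : ShuffleProtocol.{u, v, w, z} X O) (n : ℕ) : Kernel (Fin n → X) O :=
  P.analyzer n ∘ₖ P.view n n

/-- `(ε, δ, γ)`-robust shuffle differential privacy: for every intended number `n` of users,
privacy holds whenever at least a `γ` fraction of the `n` users follow the protocol. -/
def IsRobustlyPrivate (P : ShuffleProtocol.{u, v, w, z} X O) (ε δ γ : ℝ) : Prop :=
  ∀ n k : ℕ, γ * n ≤ k → k ≤ n → IsDP ε δ fun x => P.view n k x

end ShuffleProtocol

/-! ## These kernels are Markov kernels -/

instance isMarkovKernel_shuffler (Y : Type u) [MeasurableSpace Y] :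
    IsMarkovKernel (shuffler Y) := by
  refine ⟨fun a => ⟨?_⟩⟩
  change (((a.1.factorial : ℕ) : ℝ≥0∞)⁻¹ •
    ∑ σ : Equiv.Perm (Fin a.1), Measure.dirac (a.permute σ)) Set.univ = 1
  simp only [Measure.smul_apply, Measure.finsetSum_apply, measure_univ, Finset.sum_const,
    Finset.card_univ, Fintype.card_perm, Fintype.card_fin, nsmul_eq_mul, mul_one, smul_eq_mul]
  exact ENNReal.inv_mul_cancel (by simpa using Nat.factorial_ne_zero _)
    (ENNReal.natCast_ne_top _)

instance isMarkovKernel_userMessages {Ω : Type w} {X : Type u} {Y : Type z} [MeasurableSpace Ω]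
    [MeasurableSpace X] [MeasurableSpace Y] (R : Kernel (Ω × X) (Word Y)) [IsMarkovKernel R]
    (k : ℕ) : IsMarkovKernel (userMessages R k) := by
  induction k with
  | zero => unfold userMessages; infer_instance
  | succ k ih => unfold userMessages; exact Kernel.IsMarkovKernel.map _ Word.measurable_append

instance isMarkovKernel_view {X : Type u} {O : Type v} [MeasurableSpace X] [MeasurableSpace O]
    (P : ShuffleProtocol.{u, v, w, z} X O) (n k : ℕ) : IsMarkovKernel (P.view n k) := by
  unfold ShuffleProtocol.view; infer_instance

instance isMarkovKernel_exec {X : Type u} {O : Type v} [MeasurableSpace X] [MeasurableSpace O]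
    (P : ShuffleProtocol.{u, v, w, z} X O) (n : ℕ) : IsMarkovKernel (P.exec n) := by
  unfold ShuffleProtocol.exec; infer_instance

/-! ## Simple hypothesis testing -/

/-- A set of `d` hypotheses (listed as `Q 0, …, Q (d - 1)`) with pairwise total variation distance
at least `α`. -/
def IsSeparated {X : Type u} [MeasurableSpace X] {d : ℕ} (α : ℝ)
    (Q : Fin d → ProbabilityMeasure X) : Prop :=
  ∀ i j, i ≠ j → α ≤ tvDist (Q i : Measure X) (Q j : Measure X)

/-- A method for `d`-wise simple hypothesis testing over the universe `X` in the shuffle model.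
The hypotheses are known to the users and to the analyzer, so the method assigns a shuffle
protocol to every list of `d` hypotheses; the protocol outputs (the index of) a hypothesis. -/
abbrev ShuffleTester (X : Type u) [MeasurableSpace X] (d : ℕ) :=
  (Fin d → ProbabilityMeasure X) → ShuffleProtocol.{u, 0, w, z} X (Fin d)

namespace ShuffleTester

variable {X : Type u} [MeasurableSpace X] {d : ℕ}

/-- All protocols used for `α`-separated hypotheses are `(ε, δ, γ)`-robustly private. -/
def IsRobustlyPrivate (T : ShuffleTester.{u, w, z} X d) (α ε δ γ : ℝ) : Prop :=
  ∀ Q : Fin d → ProbabilityMeasure X, IsSeparated α Q → (T Q).IsRobustlyPrivate ε δ γ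

/-- `T` solves `d`-wise simple hypothesis testing with error `α` and sample complexity `n`: for
all `α`-separated hypotheses `Q` and every `i`, on `n` independent samples from `Q i` the output
is `i` with probability at least `99/100`, over the samples and the coins of the protocol. -/
def Solves (T : ShuffleTester.{u, w, z} X d) (α : ℝ) (n : ℕ) : Prop :=
  ∀ Q : Fin d → ProbabilityMeasure X, IsSeparated α Q → ∀ i : Fin d,
    99 / 100 ≤ ((T Q).exec n ∘ₘ Measure.pi fun _ : Fin n => (Q i : Measure X)) {i}

end ShuffleTester

/-! After shuffling, the order in which users contribute is invisible. The view therefore arises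
from users joining one at a time: the operators `joinUser R ν`, for a user with data of law `ν`, are
linear and commute (`commute_joinUser`), and on `n` independent samples of `ν` the view is the
`n`-th power of one operator applied to the view of nobody (`comp_view_pi`).

For `d ≥ 8` the hypotheses live on strings of `m = ⌊d/8⌋` blocks over 16 letters. Hypothesis `(b,
v)` is the uniform law whose block `b` is forced to equal `v` with probability `β = 16α/15`. Writing
`U` and `T` for the joining of a uniform and of a fully tilted user, the binomial theorem turns its
view into a mixture of `T ^ l * U ^ (n - l)` with `l` binomial (`test_tilted_pow_eq`). For `l ≤
2n/3` this is reached from `U ^ n` by replacing one user at a time. The replaced user joins uniform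
users, together at least a third of all, and the tilted users joining later are mere
post-processing. So robust privacy applies to a single family of laws, indexed by the datum of the
replaced user and common to all hypotheses; privacy for `n` users alone would not give this.

The gain from `d` to `√d` is a level-one inequality (`sum_abs_sum_blockScore_mul_le`): a function
within a factor `exp ε` of a constant has total correlation `O(ε √m)`, not `O(ε m)`, with the `16 m`
block indicators. Clamping densities (`exists_clamped_density`) reduces approximate privacy to this
case, with an additional error `O(m δ)`. Hence one replacement raises the sum of the success
probabilities over all hypotheses by `O(ε √d)` only. This sum is at most 1 on uniform data and must
reach `0.99 d`; the event `l > 2n/3` accounts for at most about `0.8 d` by Markov's inequality, so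
`n β ε √d` is at least of order `d`.

For `d < 8` a two-point argument, replacing the users' data laws one at a time, is enough. -/

/-! ## Rearrangements of words -/

namespace Word

variable {Y : Type u}

/-- The letters of `a` are the letters of `b`, in a possibly different order. -/
def Rearranges (a b : Word Y) : Prop := ∃ e : Fin a.1 ≃ Fin b.1, a.2 = b.2 ∘ e

theorem Rearranges.of_equiv {a b : Word Y} {S : Type*} (e₁ : S ≃ Fin a.1) (e₂ : S ≃ Fin b.1)
    (h : ∀ s, a.2 (e₁ s) = b.2 (e₂ s)) : Rearranges a b :=
  ⟨e₁.symm.trans e₂, funext fun i => by simpa using h (e₁.symm i)⟩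

theorem append_inl (a b : Word Y) (i : Fin a.1) :
    (append (a, b)).2 (finSumFinEquiv (m := a.1) (n := b.1) (Sum.inl i)) = a.2 i :=
  Fin.append_left a.2 b.2 i

theorem append_inr (a b : Word Y) (i : Fin b.1) :
    (append (a, b)).2 (finSumFinEquiv (m := a.1) (n := b.1) (Sum.inr i)) = b.2 i :=
  Fin.append_right a.2 b.2 i

theorem rearranges_append_permute (a b : Word Y) (σ : Equiv.Perm (Fin b.1)) :
    Rearranges (append (a, b.permute σ)) (append (a, b)) := by
  refine Rearranges.of_equiv (finSumFinEquiv (m := a.1) (n := b.1))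
    ((Equiv.sumCongr (Equiv.refl _) σ).trans (finSumFinEquiv (m := a.1) (n := b.1))) ?_
  rintro (i | i)
  · exact (append_inl a (b.permute σ) i).trans (append_inl a b i).symm
  · exact (append_inr a (b.permute σ) i).trans (append_inr a b (σ i)).symm

theorem rearranges_append_left_comm (a b c : Word Y) :
    Rearranges (append (a, append (b, c))) (append (b, append (a, c))) := by
  refine Rearranges.of_equiv (S := Fin a.1 ⊕ (Fin b.1 ⊕ Fin c.1))
    ((Equiv.sumCongr (Equiv.refl _) (finSumFinEquiv (m := b.1) (n := c.1))).trans
      (finSumFinEquiv (m := a.1) (n := b.1 + c.1)))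
    (((Equiv.sumAssoc _ _ _).symm.trans
      ((Equiv.sumCongr (Equiv.sumComm _ _) (Equiv.refl _)).trans (Equiv.sumAssoc _ _ _))).trans
      ((Equiv.sumCongr (Equiv.refl _) (finSumFinEquiv (m := a.1) (n := c.1))).trans
        (finSumFinEquiv (m := b.1) (n := a.1 + c.1)))) ?_
  rintro (i | i | i)
  · exact (append_inl a (append (b, c)) i).trans
      ((append_inr b (append (a, c)) _).trans (append_inl a c i)).symm
  · exact ((append_inr a (append (b, c)) _).trans (append_inl b c i)).trans
      (append_inl b (append (a, c)) i).symm
  · exact ((append_inr a (append (b, c)) _).trans (append_inr b c i)).trans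
      ((append_inr b (append (a, c)) _).trans (append_inr a c i)).symm

end Word

/-! ### Invariance of the shuffler under rearrangement -/

section Shuffler

variable {Y : Type u} [MeasurableSpace Y]

theorem lintegral_shuffler (a : Word Y) {f : Word Y → ℝ≥0∞} (hf : Measurable f) :
    ∫⁻ b, f b ∂(shuffler Y a) =
      ((a.1.factorial : ℕ) : ℝ≥0∞)⁻¹ * ∑ σ : Equiv.Perm (Fin a.1), f (a.permute σ) := by
  change ∫⁻ b, f b ∂(((a.1.factorial : ℕ) : ℝ≥0∞)⁻¹ •
    ∑ σ : Equiv.Perm (Fin a.1), Measure.dirac (a.permute σ)) = _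
  simp [lintegral_smul_measure, lintegral_finsetSum_measure, lintegral_dirac' _ hf]

/-- Composition with the fixed rearrangement is a bijection of the permutations, so it only
reindexes the uniform average. -/
theorem shuffler_eq_of_rearranges {a b : Word Y} (h : a.Rearranges b) :
    shuffler Y a = shuffler Y b := by
  obtain ⟨m, a⟩ := a
  obtain ⟨k, b⟩ := b
  obtain ⟨e, he⟩ := h
  obtain rfl : m = k := by simpa using Fintype.card_congr e
  refine Measure.ext_of_lintegral _ fun f hf => ?_
  rw [lintegral_shuffler _ hf, lintegral_shuffler _ hf]
  congr 1
  refine Fintype.sum_equiv (Equiv.mulLeft (e : Equiv.Perm (Fin m))) _ _ fun σ => ?_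
  have he' : a = b ∘ e := he
  rw [he']
  rfl

/-- Shuffling part of a word beforehand does not change the law of the shuffled word. -/
theorem lintegral_shuffler_append_shuffler (a b : Word Y) {f : Word Y → ℝ≥0∞}
    (hf : Measurable f) :
    ∫⁻ c, ∫⁻ e, f e ∂(shuffler Y (Word.append (a, c))) ∂(shuffler Y b) =
      ∫⁻ e, f e ∂(shuffler Y (Word.append (a, b))) := by
  have hm : Measurable fun c : Word Y => ∫⁻ e, f e ∂(shuffler Y (Word.append (a, c))) :=
    (hf.lintegral_kernel (κ := shuffler Y)).comp
      (Word.measurable_append.comp measurable_prodMk_left)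
  rw [lintegral_shuffler _ hm]
  have h : ∀ σ : Equiv.Perm (Fin b.1),
      ∫⁻ e, f e ∂(shuffler Y (Word.append (a, b.permute σ))) =
        ∫⁻ e, f e ∂(shuffler Y (Word.append (a, b))) := fun σ => by
    rw [shuffler_eq_of_rearranges (Word.rearranges_append_permute a b σ)]
  simp only [h, Finset.sum_const, Finset.card_univ, Fintype.card_perm, Fintype.card_fin,
    nsmul_eq_mul, ← mul_assoc]
  rw [ENNReal.inv_mul_cancel (by simpa using Nat.factorial_ne_zero _)
    (ENNReal.natCast_ne_top _), one_mul]

theorem shuffler_append_left_comm (a b c : Word Y) :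
    shuffler Y (Word.append (a, Word.append (b, c))) =
      shuffler Y (Word.append (b, Word.append (a, c))) :=
  shuffler_eq_of_rearranges (Word.rearranges_append_left_comm a b c)

end Shuffler

/-! ## Adding one user to a shuffled collection of messages -/

section Join

variable {Ω : Type w} {X : Type u} {Y : Type z} [MeasurableSpace Ω] [MeasurableSpace X]
  [MeasurableSpace Y] (R : Kernel (Ω × X) (Word Y)) [IsMarkovKernel R]

/-- A user with given data adds their messages to a shuffled collection of messages, which is
then shuffled again. -/
noncomputable def joinKernel : Kernel ((Ω × Word Y) × X) (Ω × Word Y) :=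
  Kernel.deterministic (fun p => p.1.1) (by fun_prop) ×ₖ
    (shuffler Y ∘ₖ ((R.comap (fun p : (Ω × Word Y) × X => (p.1.1, p.2)) (by fun_prop)) ×ₖ
      Kernel.deterministic (fun p : (Ω × Word Y) × X => p.1.2) (by fun_prop)).map Word.append)

instance : IsMarkovKernel (joinKernel R) := by
  have := Kernel.IsMarkovKernel.map
    ((R.comap (fun p : (Ω × Word Y) × X => (p.1.1, p.2)) (by fun_prop)) ×ₖ
      Kernel.deterministic (fun p : (Ω × Word Y) × X => p.1.2) (by fun_prop))
      Word.measurable_append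
  unfold joinKernel
  infer_instance

theorem lintegral_joinKernel (p : (Ω × Word Y) × X) {f : Ω × Word Y → ℝ≥0∞}
    (hf : Measurable f) :
    ∫⁻ s, f s ∂(joinKernel R p) =
      ∫⁻ a, ∫⁻ b, f (p.1.1, b) ∂(shuffler Y (Word.append (a, p.1.2))) ∂(R (p.1.1, p.2)) := by
  have h1 : Measurable fun b => f (p.1.1, b) := hf.comp measurable_prodMk_left
  have h2 := h1.lintegral_kernel (κ := shuffler Y)
  have := Kernel.IsMarkovKernel.map
    ((R.comap (fun p : (Ω × Word Y) × X => (p.1.1, p.2)) (by fun_prop)) ×ₖ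
      Kernel.deterministic (fun p : (Ω × Word Y) × X => p.1.2) (by fun_prop))
      Word.measurable_append
  rw [joinKernel, Kernel.lintegral_deterministic_prod _ _ _ hf, Kernel.lintegral_comp _ _ _ h1,
    Kernel.lintegral_map _ Word.measurable_append _ h2,
    Kernel.lintegral_prod_deterministic (g := fun q : Word Y × Word Y =>
      ∫⁻ b, f (p.1.1, b) ∂(shuffler Y (Word.append q))) _ _ _ (h2.comp Word.measurable_append)]
  rfl

/-- The last shuffle absorbs the intermediate one. Either order then shuffles the same letters, and
Fubini exchanges the two independent randomizers. -/
theorem lintegral_joinKernel_comm (s : Ω × Word Y) (x y : X) {f : Ω × Word Y → ℝ≥0∞}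
    (hf : Measurable f) :
    ∫⁻ s', ∫⁻ t, f t ∂(joinKernel R (s', y)) ∂(joinKernel R (s, x)) =
      ∫⁻ s', ∫⁻ t, f t ∂(joinKernel R (s', x)) ∂(joinKernel R (s, y)) := by
  have key : ∀ x y : X, ∫⁻ s', ∫⁻ t, f t ∂(joinKernel R (s', y)) ∂(joinKernel R (s, x)) =
      ∫⁻ a, ∫⁻ b, ∫⁻ e, f (s.1, e) ∂(shuffler Y (Word.append (b, Word.append (a, s.2))))
        ∂(R (s.1, y)) ∂(R (s.1, x)) := by
    intro x y
    have h1 : Measurable fun b => f (s.1, b) := hf.comp measurable_prodMk_left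
    have h2 := h1.lintegral_kernel (κ := shuffler Y)
    have hm : Measurable fun s' => ∫⁻ t, f t ∂(joinKernel R (s', y)) :=
      (hf.lintegral_kernel (κ := joinKernel R)).comp measurable_prodMk_right
    rw [lintegral_joinKernel R _ hm]
    refine lintegral_congr fun a => ?_
    simp only [lintegral_joinKernel R _ hf]
    have h3 : Measurable (Function.uncurry fun w b : Word Y =>
        ∫⁻ e, f (s.1, e) ∂(shuffler Y (Word.append (b, w)))) :=
      h2.comp (Word.measurable_append.comp measurable_swap)
    rw [lintegral_lintegral_swap h3.aemeasurable]
    exact lintegral_congr fun b => lintegral_shuffler_append_shuffler b _ h1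
  rw [key, key]
  have h1 : Measurable fun b => f (s.1, b) := hf.comp measurable_prodMk_left
  have h2 := h1.lintegral_kernel (κ := shuffler Y)
  rw [lintegral_lintegral_swap]
  · refine lintegral_congr fun a => lintegral_congr fun b => ?_
    rw [shuffler_append_left_comm]
  · exact (h2.comp (Word.measurable_append.comp (measurable_snd.prodMk
      (Word.measurable_append.comp (measurable_fst.prodMk measurable_const))))).aemeasurable

/-- The effect on the law of the shuffled messages of adding a user with random data of law
`ν`. -/
noncomputable def joinUser (ν : Measure X) :
    Module.End ℝ≥0∞ (Measure (Ω × Word Y)) where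
  -- Linearity in the measure places the operator in the ring `Module.End`, where powers and the
  -- binomial theorem are available.
  toFun m := m.bind (joinKernel R ∘ₖ (Kernel.id ×ₖ Kernel.const _ ν))
  map_add' m m' := by
    refine Measure.ext_of_lintegral _ fun f hf => ?_
    simp [Measure.lintegral_bind (Kernel.aemeasurable _) hf.aemeasurable, lintegral_add_measure]
  map_smul' c m := by
    refine Measure.ext_of_lintegral _ fun f hf => ?_
    simp [Measure.lintegral_bind (Kernel.aemeasurable _) hf.aemeasurable, lintegral_smul_measure]

theorem lintegral_joinUser (ν : Measure X) [SFinite ν] (m : Measure (Ω × Word Y))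
    {f : Ω × Word Y → ℝ≥0∞} (hf : Measurable f) :
    ∫⁻ t, f t ∂(joinUser R ν m) = ∫⁻ s, ∫⁻ x, ∫⁻ t, f t ∂(joinKernel R (s, x)) ∂ν ∂m := by
  change ∫⁻ t, f t ∂(m.bind (joinKernel R ∘ₖ (Kernel.id ×ₖ Kernel.const _ ν))) = _
  rw [Measure.lintegral_bind (Kernel.aemeasurable _) hf.aemeasurable]
  refine lintegral_congr fun s => ?_
  rw [Kernel.lintegral_comp _ _ _ hf,
    Kernel.lintegral_id_prod (hf.lintegral_kernel (κ := joinKernel R))]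
  rfl

theorem measurable_lintegral_joinKernel (ν : Measure X) [SFinite ν]
    {f : Ω × Word Y → ℝ≥0∞} (hf : Measurable f) :
    Measurable fun s => ∫⁻ x, ∫⁻ t, f t ∂(joinKernel R (s, x)) ∂ν :=
  (hf.lintegral_kernel (κ := joinKernel R)).lintegral_prod_right'

theorem commute_joinUser (ν ν' : Measure X) [SFinite ν] [SFinite ν'] :
    Commute (joinUser R ν) (joinUser R ν') := by
  refine LinearMap.ext fun m => Measure.ext_of_lintegral _ fun f hf => ?_
  have key : ∀ (ν ν' : Measure X) [SFinite ν] [SFinite ν'],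
      ∫⁻ t, f t ∂(joinUser R ν (joinUser R ν' m)) = ∫⁻ s, ∫⁻ x, ∫⁻ y,
        ∫⁻ s', ∫⁻ t, f t ∂(joinKernel R (s', y)) ∂(joinKernel R (s, x)) ∂ν ∂ν' ∂m := by
    intro ν ν' _ _
    rw [lintegral_joinUser R ν _ hf,
      lintegral_joinUser R ν' _ (measurable_lintegral_joinKernel R ν hf)]
    refine lintegral_congr fun s => lintegral_congr fun x => ?_
    rw [lintegral_lintegral_swap (hf.lintegral_kernel (κ := joinKernel R)).aemeasurable]
  change ∫⁻ t, f t ∂(joinUser R ν (joinUser R ν' m)) =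
    ∫⁻ t, f t ∂(joinUser R ν' (joinUser R ν m))
  rw [key, key]
  refine lintegral_congr fun s => ?_
  rw [lintegral_lintegral_swap]
  · exact lintegral_congr fun x => lintegral_congr fun y => lintegral_joinKernel_comm R s y x hf
  · have hg := hf.lintegral_kernel (κ := joinKernel R)
    have : Measurable fun q : (X × X) × (Ω × Word Y) =>
        ∫⁻ t, f t ∂(joinKernel R (q.2, q.1.2)) := hg.comp (by fun_prop)
    exact (this.lintegral_kernel_prod_right' (κ := (joinKernel R).comap
      (fun q : X × X => (s, q.1)) (by fun_prop))).aemeasurable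

end Join

/-! ### Mixtures of data laws, and tests after later arrivals -/

section JoinMore

variable {Ω : Type w} {X : Type u} {Y : Type z} [MeasurableSpace Ω] [MeasurableSpace X]
  [MeasurableSpace Y] (R : Kernel (Ω × X) (Word Y)) [IsMarkovKernel R]

theorem lintegral_joinUser_dirac (x : X) (m : Measure (Ω × Word Y))
    {f : Ω × Word Y → ℝ≥0∞} (hf : Measurable f) :
    ∫⁻ t, f t ∂(joinUser R (Measure.dirac x) m) = ∫⁻ s, ∫⁻ t, f t ∂(joinKernel R (s, x)) ∂m := by
  rw [lintegral_joinUser R _ _ hf]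
  refine lintegral_congr fun s => ?_
  exact lintegral_dirac' _
    ((hf.lintegral_kernel (κ := joinKernel R)).comp (measurable_prodMk_left (x := s)))

/-- Linearity in the law of the joining user reduces finitely supported laws to point masses, which
privacy compares. -/
theorem joinUser_sum_smul {I : Type*} (s : Finset I) (w : I → ℝ≥0∞) (ν : I → Measure X)
    [∀ i, SFinite (ν i)] (m : Measure (Ω × Word Y)) :
    joinUser R (∑ i ∈ s, w i • ν i) m = ∑ i ∈ s, w i • joinUser R (ν i) m := by
  refine Measure.ext_of_lintegral _ fun f hf => ?_
  have hm : ∀ i, Measurable fun s => ∫⁻ x, ∫⁻ t, f t ∂(joinKernel R (s, x)) ∂(ν i) :=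
    fun i => measurable_lintegral_joinKernel R (ν i) hf
  have hs : SFinite (∑ i ∈ s, w i • ν i) := by
    classical
    induction s using Finset.induction with
    | empty => simpa using inferInstanceAs (SFinite (0 : Measure X))
    | insert i s hi ih => rw [Finset.sum_insert hi]; infer_instance
  rw [lintegral_joinUser R _ _ hf, lintegral_finsetSum_measure]
  simp only [lintegral_finsetSum_measure, lintegral_smul_measure, lintegral_joinUser R _ _ hf,
    smul_eq_mul]
  rw [lintegral_finsetSum _ fun i _ => (hm i).const_mul (w i)]
  refine Finset.sum_congr rfl fun i _ => ?_
  exact lintegral_const_mul _ (hm i)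

theorem joinUser_smul_add_smul (a b : ℝ≥0∞) (ν ν' : Measure X) [SFinite ν] [SFinite ν'] :
    joinUser R (a • ν + b • ν') = a • joinUser R ν + b • joinUser R ν' := by
  refine LinearMap.ext fun m => ?_
  have (i : Bool) : SFinite (cond i ν ν') := by cases i <;> simpa
  simpa using joinUser_sum_smul R Finset.univ (fun i : Bool => cond i a b)
    (fun i => cond i ν ν') m

/-- Adding a user and then applying a test amounts to applying another test. -/
theorem exists_test_joinUser_pow (ν : Measure X) [IsProbabilityMeasure ν]
    {g : Ω × Word Y → ℝ≥0∞} (hg : Measurable g) (hg1 : ∀ s, g s ≤ 1) (t : ℕ) :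
    ∃ G : Ω × Word Y → ℝ≥0∞, Measurable G ∧ (∀ s, G s ≤ 1) ∧
      ∀ m, ∫⁻ s, g s ∂((joinUser R ν ^ t) m) = ∫⁻ s, G s ∂m := by
  induction t with
  | zero => exact ⟨g, hg, hg1, fun m => by simp⟩
  | succ t ih =>
    obtain ⟨G, hG, hG1, h⟩ := ih
    refine ⟨fun s => ∫⁻ x, ∫⁻ t, G t ∂(joinKernel R (s, x)) ∂ν,
      measurable_lintegral_joinKernel R ν hG, fun s => ?_, fun m => ?_⟩
    · calc ∫⁻ x, ∫⁻ t, G t ∂(joinKernel R (s, x)) ∂ν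
          ≤ ∫⁻ x, ∫⁻ t, 1 ∂(joinKernel R (s, x)) ∂ν :=
            lintegral_mono fun x => lintegral_mono fun t => hG1 t
        _ = 1 := by simp
    · rw [pow_succ, Module.End.mul_apply, h, lintegral_joinUser R ν m hG]

end JoinMore

/-! ### The view as a sequence of arrivals -/

section View

variable {X : Type u} {O : Type v} [MeasurableSpace X] [MeasurableSpace O]
  (P : ShuffleProtocol.{u, v, w, z} X O) (n : ℕ)

theorem lintegral_userMessages_succ {Ω : Type w} {Y : Type z} [MeasurableSpace Ω]
    [MeasurableSpace Y] (R : Kernel (Ω × X) (Word Y)) [IsMarkovKernel R] (k : ℕ)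
    (ω : Ω) (x : Fin (k + 1) → X) {f : Word Y → ℝ≥0∞} (hf : Measurable f) :
    ∫⁻ c, f c ∂(userMessages R (k + 1) (ω, x)) =
      ∫⁻ a, ∫⁻ c, f (Word.append (a, c)) ∂(userMessages R k (ω, Fin.tail x)) ∂(R (ω, x 0)) := by
  rw [userMessages, Kernel.lintegral_map _ Word.measurable_append _ hf,
    Kernel.lintegral_prod (g := fun q => f (Word.append q)) _ _ _ (hf.comp Word.measurable_append)]
  rfl

namespace ShuffleProtocol

theorem lintegral_view (k : ℕ) (x : Fin k → X) {f : P.Coins × Word P.Msg → ℝ≥0∞}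
    (hf : Measurable f) :
    ∫⁻ s, f s ∂(P.view n k x) = ∫⁻ ω, ∫⁻ c, ∫⁻ b, f (ω, b) ∂(shuffler P.Msg c)
      ∂(userMessages (P.randomizer n) k (ω, x)) ∂(P.coinLaw n) := by
  rw [view, Kernel.lintegral_compProd _ _ _ hf]
  refine lintegral_congr fun ω => ?_
  rw [Kernel.lintegral_comap]
  exact Kernel.lintegral_comp _ _ _ (hf.comp (measurable_prodMk_left (x := ω)))

/-- Adding messages to an already shuffled collection and shuffling again has the same law as a
single shuffle of everything. -/
theorem view_succ (k : ℕ) (x : Fin (k + 1) → X) :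
    P.view n (k + 1) x =
      joinUser (P.randomizer n) (Measure.dirac (x 0)) (P.view n k (Fin.tail x)) := by
  refine Measure.ext_of_lintegral _ fun f hf => ?_
  have hm : Measurable fun s => ∫⁻ t, f t ∂(joinKernel (P.randomizer n) (s, x 0)) :=
    (hf.lintegral_kernel (κ := joinKernel (P.randomizer n))).comp measurable_prodMk_right
  rw [lintegral_joinUser_dirac _ _ _ hf, lintegral_view P n _ _ hf, lintegral_view P n _ _ hm]
  refine lintegral_congr fun ω => ?_
  have h1 : Measurable fun b => f (ω, b) := hf.comp measurable_prodMk_left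
  have h2 := h1.lintegral_kernel (κ := shuffler P.Msg)
  rw [lintegral_userMessages_succ _ _ _ _ h2, lintegral_lintegral_swap]
  · refine lintegral_congr fun c => ?_
    simp only [lintegral_joinKernel _ _ hf]
    rw [lintegral_lintegral_swap]
    · exact lintegral_congr fun a => (lintegral_shuffler_append_shuffler a c h1).symm
    · exact (h2.comp (Word.measurable_append.comp measurable_swap)).aemeasurable
  · exact (h2.comp Word.measurable_append).aemeasurable

theorem measurable_cons (k : ℕ) :
    Measurable fun p : X × (Fin k → X) => (Fin.cons p.1 p.2 : Fin (k + 1) → X) := by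
  refine measurable_pi_iff.2 fun i => ?_
  induction i using Fin.cases with
  | zero => simpa using measurable_fst
  | succ i => exact (measurable_pi_apply i).comp measurable_snd

theorem joinUser_comp_view (k : ℕ) (ν : Measure X) [IsProbabilityMeasure ν]
    (ρ : Measure (Fin k → X)) [IsProbabilityMeasure ρ] :
    joinUser (P.randomizer n) ν (P.view n k ∘ₘ ρ) =
      P.view n (k + 1) ∘ₘ ((ν.prod ρ).map fun p => (Fin.cons p.1 p.2 : Fin (k + 1) → X)) := by
  refine Measure.ext_of_lintegral _ fun f hf => ?_
  have hm := measurable_lintegral_joinKernel (P.randomizer n) ν hf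
  have hv := hf.lintegral_kernel (κ := P.view n (k + 1))
  rw [lintegral_joinUser _ _ _ hf, Measure.lintegral_bind (Kernel.aemeasurable _) hm.aemeasurable,
    Measure.lintegral_bind (Kernel.aemeasurable _) hf.aemeasurable,
    lintegral_map hv (measurable_cons k),
    lintegral_prod_symm' (fun p : X × (Fin k → X) => ∫⁻ b, f b ∂(P.view n (k + 1)
      (Fin.cons p.1 p.2))) (hv.comp (measurable_cons k))]
  refine lintegral_congr fun x => ?_
  rw [lintegral_lintegral_swap (hf.lintegral_kernel
    (κ := joinKernel (P.randomizer n))).aemeasurable]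
  refine lintegral_congr fun y => ?_
  rw [view_succ, lintegral_joinUser_dirac _ _ _ hf]
  simp

/-- The measure `m` is the law of the view of `k` users with some random data. -/
def IsViewLaw (k : ℕ) (m : Measure (P.Coins × Word P.Msg)) : Prop :=
  ∃ ρ : Measure (Fin k → X), IsProbabilityMeasure ρ ∧ m = P.view n k ∘ₘ ρ

variable {P n}

theorem IsViewLaw.isProbabilityMeasure {k : ℕ} {m : Measure (P.Coins × Word P.Msg)}
    (h : P.IsViewLaw n k m) : IsProbabilityMeasure m := by
  obtain ⟨ρ, _, rfl⟩ := h
  infer_instance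

theorem IsViewLaw.joinUser {k : ℕ} {m : Measure (P.Coins × Word P.Msg)} (h : P.IsViewLaw n k m)
    (ν : Measure X) [IsProbabilityMeasure ν] :
    P.IsViewLaw n (k + 1) (joinUser (P.randomizer n) ν m) := by
  obtain ⟨ρ, _, rfl⟩ := h
  exact ⟨_, Measure.isProbabilityMeasure_map (measurable_cons k).aemeasurable,
    joinUser_comp_view P n k ν ρ⟩

theorem IsViewLaw.joinUser_pow {k : ℕ} {m : Measure (P.Coins × Word P.Msg)}
    (h : P.IsViewLaw n k m) (ν : Measure X) [IsProbabilityMeasure ν] (t : ℕ) :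
    P.IsViewLaw n (k + t) ((_root_.joinUser (P.randomizer n) ν ^ t) m) := by
  induction t with
  | zero => simpa using h
  | succ t ih =>
    rw [pow_succ', Module.End.mul_apply]
    exact ih.joinUser ν

/-- Privacy of the view with respect to the data of the user who joins last. -/
theorem IsViewLaw.joinUser_dirac_le {k : ℕ} {m : Measure (P.Coins × Word P.Msg)} {ε δ : ℝ}
    (h : P.IsViewLaw n k m) (hP : IsDP ε δ fun x => P.view n (k + 1) x) (x x' : X)
    {C : Set (P.Coins × Word P.Msg)} (hC : MeasurableSet C) :
    _root_.joinUser (P.randomizer n) (Measure.dirac x) m C ≤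
      ENNReal.ofReal (Real.exp ε) * _root_.joinUser (P.randomizer n) (Measure.dirac x') m C +
        ENNReal.ofReal δ := by
  obtain ⟨ρ, _, rfl⟩ := h
  have key : ∀ x, _root_.joinUser (P.randomizer n) (Measure.dirac x) (P.view n k ∘ₘ ρ) C =
      ∫⁻ y, P.view n (k + 1) (Fin.cons x y) C ∂ρ := fun x => by
    rw [joinUser_comp_view, Measure.bind_apply hC (Kernel.aemeasurable _),
      lintegral_map (Kernel.measurable_coe _ hC) (measurable_cons k),
      lintegral_prod_symm' (fun p : X × (Fin k → X) => P.view n (k + 1) (Fin.cons p.1 p.2) C)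
        ((Kernel.measurable_coe _ hC).comp (measurable_cons k))]
    refine lintegral_congr fun y => ?_
    exact lintegral_dirac' _ (((Kernel.measurable_coe _ hC).comp (measurable_cons k)).comp
      (measurable_prodMk_right (y := y)))
  have hm : Measurable fun y : Fin k → X => P.view n (k + 1) (Fin.cons x' y) C :=
    ((Kernel.measurable_coe _ hC).comp (measurable_cons k)).comp measurable_prodMk_left
  rw [key, key]
  calc ∫⁻ y, P.view n (k + 1) (Fin.cons x y) C ∂ρ
      ≤ ∫⁻ y, (ENNReal.ofReal (Real.exp ε) * P.view n (k + 1) (Fin.cons x' y) C +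
          ENNReal.ofReal δ) ∂ρ := lintegral_mono fun y => by
        refine hP _ _ (fun i hi j hj => ?_) C hC
        have h0 : ∀ i : Fin (k + 1), (Fin.cons x y : Fin (k + 1) → X) i ≠
            (Fin.cons x' y : Fin (k + 1) → X) i → i = 0 := by
          intro i
          induction i using Fin.cases with
          | zero => simp
          | succ i => simp
        rw [h0 i hi, h0 j hj]
    _ = _ := by
        rw [lintegral_add_right _ measurable_const, lintegral_const_mul _ hm]
        simp

variable (P n)

/-- The law of the view when no user follows the protocol. -/
noncomputable def emptyView : Measure (P.Coins × Word P.Msg) := P.view n 0 Fin.elim0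

theorem isViewLaw_emptyView : P.IsViewLaw n 0 (P.emptyView n) := by
  refine ⟨Measure.dirac Fin.elim0, inferInstance, ?_⟩
  rw [Measure.dirac_bind (Kernel.measurable _)]
  rfl

theorem comp_view_pi (ν : Measure X) [IsProbabilityMeasure ν] (k : ℕ) :
    P.view n k ∘ₘ (Measure.pi fun _ => ν) =
      (joinUser (P.randomizer n) ν ^ k) (P.emptyView n) := by
  induction k with
  | zero =>
    rw [Measure.pi_of_empty (x := Fin.elim0), Measure.dirac_bind (Kernel.measurable _)]
    rfl
  | succ k ih =>
    rw [pow_succ', Module.End.mul_apply, ← ih, joinUser_comp_view]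
    congr 1
    rw [← (measurePreserving_piFinSuccAbove (fun _ : Fin (k + 1) => ν) 0).symm.map_eq]
    congr 1
    funext p
    exact Fin.insertNth_zero' p.1 p.2

theorem exec_comp_pi_apply (ν : Measure X) [IsProbabilityMeasure ν] {A : Set O}
    (hA : MeasurableSet A) :
    (P.exec n ∘ₘ (Measure.pi fun _ => ν)) A =
      ∫⁻ s, P.analyzer n s A ∂((joinUser (P.randomizer n) ν ^ n) (P.emptyView n)) := by
  rw [exec, ← Measure.comp_assoc, comp_view_pi, Measure.bind_apply hA (Kernel.aemeasurable _)]

end ShuffleProtocol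

end View

/-! ## Densities of differentially private families of measures -/

section Density

variable {S : Type u} [MeasurableSpace S] {Y : Type v} [Fintype Y]

/-- A family of probability measures any two of which are `(ε, δ)`-indistinguishable has densities
that are, up to an error `2 δ` in `L¹`, within a factor `exp ε` of their average. -/
theorem exists_clamped_density [Nonempty Y] (M : Y → Measure S) [∀ x, IsProbabilityMeasure (M x)]
    {ε δ : ℝ} (hε : 0 < ε) (hδ : 0 ≤ δ)
    (hM : ∀ x x' C, MeasurableSet C →
      M x C ≤ ENNReal.ofReal (Real.exp ε) * M x' C + ENNReal.ofReal δ) :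
    ∃ (μ : Measure S) (p q : Y → S → ℝ) (P : S → ℝ),
      (∀ x, Integrable (p x) μ) ∧ (∀ x, Integrable (q x) μ) ∧ Integrable P μ ∧
      (∀ x s, Real.exp (-ε) * P s ≤ q x s ∧ q x s ≤ Real.exp ε * P s) ∧
      (∀ s, 0 ≤ P s) ∧ (∀ s, ∑ x, q x s ≤ 2 * (Fintype.card Y * P s)) ∧
      (∀ x (G : S → ℝ), ∫ s, G s ∂(M x) = ∫ s, p x s * G s ∂μ) ∧
      (∀ x, ∫ s, |p x s - q x s| ∂μ ≤ 2 * δ) ∧ ∫ s, P s ∂μ = 1 := by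
  have hcard : (0 : ℝ) < Fintype.card Y := by exact_mod_cast Fintype.card_pos
  have hMr : ∀ x x' C, MeasurableSet C → (M x).real C ≤ Real.exp ε * (M x').real C + δ := by
    intro x x' C hC
    have h := ENNReal.toReal_mono (by finiteness) (hM x x' C hC)
    rwa [ENNReal.toReal_add (by finiteness) (by finiteness), ENNReal.toReal_mul,
      ENNReal.toReal_ofReal (Real.exp_pos ε).le, ENNReal.toReal_ofReal hδ] at h
  let μ : Measure S := ∑ x, M x
  have hac : ∀ x, M x ≪ μ := fun x => Measure.absolutelyContinuous_of_le fun C => by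
    rw [Measure.finsetSum_apply]
    exact Finset.single_le_sum (f := fun x => M x C) (fun _ _ => zero_le) (Finset.mem_univ x)
  let p : Y → S → ℝ := fun x s => ((M x).rnDeriv μ s).toReal
  have hpm : ∀ x, Measurable (p x) := fun x => (Measure.measurable_rnDeriv _ _).ennreal_toReal
  have hp0 : ∀ x s, 0 ≤ p x s := fun x s => ENNReal.toReal_nonneg
  have hpi : ∀ x, Integrable (p x) μ := fun x => Measure.integrable_toReal_rnDeriv
  have hpC : ∀ x C, ∫ s in C, p x s ∂μ = (M x).real C := fun x C =>
    Measure.setIntegral_toReal_rnDeriv (hac x) C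
  let P : S → ℝ := fun s => (Fintype.card Y : ℝ)⁻¹ * ∑ x, p x s
  have hPm : Measurable P := (Finset.measurable_fun_sum _ fun x _ => hpm x).const_mul _
  have hP0 : ∀ s, 0 ≤ P s := fun s =>
    mul_nonneg (inv_nonneg.2 hcard.le) (Finset.sum_nonneg fun x _ => hp0 x s)
  have hPi : Integrable P μ := (integrable_finsetSum _ fun x _ => hpi x).const_mul _
  have hPC : ∀ C, ∫ s in C, P s ∂μ = (Fintype.card Y : ℝ)⁻¹ * ∑ x, (M x).real C := by
    intro C
    simp only [P]
    rw [integral_const_mul, integral_finsetSum _ fun x _ => (hpi x).integrableOn]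
    simp only [hpC]
  have hsum : ∀ s, ∑ x, p x s = Fintype.card Y * P s := fun s => by
    simp only [P]; field_simp
  -- The density is clamped to the window `[exp (-ε) * P, exp ε * P]`; privacy bounds by `δ` the
  -- mass cut off on each side.
  let q : Y → S → ℝ := fun x s =>
    max (Real.exp (-ε) * P s) (min (Real.exp ε * P s) (p x s))
  have hle : ∀ s, Real.exp (-ε) * P s ≤ Real.exp ε * P s := fun s =>
    mul_le_mul_of_nonneg_right (Real.exp_le_exp.2 (by linarith)) (hP0 s)
  have hqi : ∀ x, Integrable (q x) μ := fun x =>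
    (hPi.const_mul _).sup ((hPi.const_mul _).inf (hpi x))
  refine ⟨μ, p, q, P, hpi, hqi, hPi, fun x s => ⟨le_max_left _ _,
    max_le (hle s) (min_le_left _ _)⟩, hP0, fun s => ?_, fun x G => ?_, fun x => ?_, ?_⟩
  · have hexp : Real.exp (-ε) ≤ 1 := Real.exp_le_one_iff.2 (by linarith)
    calc ∑ x, q x s ≤ ∑ x, (P s + p x s) := by
          refine Finset.sum_le_sum fun x _ => max_le ?_ ?_
          · nlinarith [hP0 s, hp0 x s]
          · exact (min_le_right _ _).trans (by linarith [hP0 s])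
      _ = 2 * (Fintype.card Y * P s) := by
          rw [Finset.sum_add_distrib, hsum]
          simp [two_mul]
  · exact (integral_rnDeriv_smul (hac x) (f := G)).symm
  · have havg : ∀ c : ℝ, (Fintype.card Y : ℝ)⁻¹ * ∑ _y : Y, c = c := fun c => by
      simp
    -- The excess lives on the event `C` where it is positive. Privacy of `M x` against every `M y`
    -- on `C` is averaged over `y`, which produces `P`.
    have h1 : ∫ s, max (p x s - Real.exp ε * P s) 0 ∂μ ≤ δ := by
      let C := {s | Real.exp ε * P s < p x s}
      have hC : MeasurableSet C := measurableSet_lt (hPm.const_mul _) (hpm x)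
      have : ∫ s, max (p x s - Real.exp ε * P s) 0 ∂μ =
          ∫ s in C, (p x s - Real.exp ε * P s) ∂μ := by
        rw [← integral_indicator hC]
        refine integral_congr_ae (Filter.Eventually.of_forall fun s => ?_)
        by_cases hs : s ∈ C
        · simpa [hs] using le_of_lt hs
        · simpa [hs] using not_lt.1 hs
      rw [this, integral_sub (hpi x).integrableOn (hPi.const_mul _).integrableOn,
        integral_const_mul, hpC, hPC]
      have : (Fintype.card Y : ℝ)⁻¹ * ∑ _y : Y, (M x).real C ≤
          (Fintype.card Y : ℝ)⁻¹ * ∑ y, (Real.exp ε * (M y).real C + δ) := by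
        gcongr with y
        exact hMr x y C hC
      rw [havg, Finset.sum_add_distrib, mul_add, havg, ← Finset.mul_sum] at this
      linarith
    have h2 : ∫ s, max (Real.exp (-ε) * P s - p x s) 0 ∂μ ≤ δ := by
      let C := {s | p x s < Real.exp (-ε) * P s}
      have hC : MeasurableSet C := measurableSet_lt (hpm x) (hPm.const_mul _)
      have : ∫ s, max (Real.exp (-ε) * P s - p x s) 0 ∂μ =
          ∫ s in C, (Real.exp (-ε) * P s - p x s) ∂μ := by
        rw [← integral_indicator hC]
        refine integral_congr_ae (Filter.Eventually.of_forall fun s => ?_)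
        by_cases hs : s ∈ C
        · simpa [hs] using le_of_lt hs
        · simpa [hs] using not_lt.1 hs
      rw [this, integral_sub (hPi.const_mul _).integrableOn (hpi x).integrableOn,
        integral_const_mul, hpC, hPC]
      -- Privacy is used in the other direction, every `M y` against `M x`, and then divided by `exp
      -- ε`.
      have h3 : (Fintype.card Y : ℝ)⁻¹ * ∑ y, (M y).real C ≤
          (Fintype.card Y : ℝ)⁻¹ * ∑ _y : Y, (Real.exp ε * (M x).real C + δ) := by
        gcongr with y
        exact hMr y x C hC
      rw [havg] at h3
      have hexp : Real.exp (-ε) ≤ 1 := Real.exp_le_one_iff.2 (by linarith)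
      have h4 := mul_le_mul_of_nonneg_left h3 (Real.exp_pos (-ε)).le
      rw [mul_add, ← mul_assoc _ (Real.exp ε), ← Real.exp_add, neg_add_cancel, Real.exp_zero,
        one_mul] at h4
      nlinarith
    have i1 : Integrable (fun s => max (p x s - Real.exp ε * P s) 0) μ :=
      ((hpi x).sub (hPi.const_mul _)).sup (integrable_zero _ _ _)
    have i2 : Integrable (fun s => max (Real.exp (-ε) * P s - p x s) 0) μ :=
      ((hPi.const_mul _).sub (hpi x)).sup (integrable_zero _ _ _)
    calc ∫ s, |p x s - q x s| ∂μ
        ≤ ∫ s, (max (p x s - Real.exp ε * P s) 0 + max (Real.exp (-ε) * P s - p x s) 0) ∂μ := by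
          refine integral_mono ((hpi x).sub (hqi x)).abs (i1.add i2) fun s => ?_
          have := hle s
          simp only [q]
          rcases le_total (Real.exp ε * P s) (p x s) with h | h <;>
          rcases le_total (p x s) (Real.exp (-ε) * P s) with h' | h'
          · rw [min_eq_left h, max_eq_right this, max_eq_left (by linarith),
              max_eq_left (by linarith), abs_of_nonneg (by linarith)]
            linarith
          · rw [min_eq_left h, max_eq_right this, max_eq_left (by linarith),
              max_eq_right (by linarith), abs_of_nonneg (by linarith)]
            linarith
          · rw [min_eq_right h, max_eq_left h', max_eq_right (by linarith),
              max_eq_left (by linarith), abs_of_nonpos (by linarith)]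
            linarith
          · rw [min_eq_right h, max_eq_right h', max_eq_right (by linarith),
              max_eq_right (by linarith)]
            simp
      _ ≤ 2 * δ := by
          rw [integral_add i1 i2]
          linarith
  · have := hPC Set.univ
    simpa [hcard.ne'] using this

/-- Differential privacy for bounded tests. -/
theorem abs_integral_sub_integral_le [Nonempty Y] (M : Y → Measure S)
    [∀ x, IsProbabilityMeasure (M x)] {ε δ : ℝ} (hε : 0 < ε) (hδ : 0 ≤ δ)
    (hM : ∀ x x' C, MeasurableSet C →
      M x C ≤ ENNReal.ofReal (Real.exp ε) * M x' C + ENNReal.ofReal δ)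
    {G : S → ℝ} (hG : Measurable G) (hG0 : ∀ s, 0 ≤ G s) (hG1 : ∀ s, G s ≤ 1) (x y : Y) :
    |∫ s, G s ∂(M x) - ∫ s, G s ∂(M y)| ≤ Real.exp ε - Real.exp (-ε) + 4 * δ := by
  obtain ⟨μ, p, q, P, hpi, hqi, hPi, hq, hP0, -, hG', hpq, hP⟩ :=
    exists_clamped_density M hε hδ hM
  have hGb : ∀ s, |G s| ≤ 1 := fun s => abs_le.2 ⟨by linarith [hG0 s], hG1 s⟩
  have hmul : ∀ {f : S → ℝ}, Integrable f μ → Integrable (fun s => f s * G s) μ := fun hf =>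
    hf.mul_bdd (c := 1) hG.aestronglyMeasurable (Filter.Eventually.of_forall hGb)
  rw [hG', hG', ← integral_sub (hmul (hpi x)) (hmul (hpi y))]
  calc |∫ s, (p x s * G s - p y s * G s) ∂μ|
      ≤ ∫ s, |p x s * G s - p y s * G s| ∂μ := abs_integral_le_integral_abs
    _ ≤ ∫ s, (|p x s - q x s| + |p y s - q y s| + (Real.exp ε - Real.exp (-ε)) * P s) ∂μ := by
        refine integral_mono ((hmul (hpi x)).sub (hmul (hpi y))).abs
          ((((hpi x).sub (hqi x)).abs.add ((hpi y).sub (hqi y)).abs).add (hPi.const_mul _))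
          fun s => ?_
        have h1 : |q x s - q y s| ≤ (Real.exp ε - Real.exp (-ε)) * P s :=
          abs_le.2 ⟨by linarith [hq x s, hq y s], by linarith [hq x s, hq y s]⟩
        have h2 : p x s * G s - p y s * G s =
          ((p x s - q x s) + (q x s - q y s) + (q y s - p y s)) * G s := by ring
        change |p x s * G s - p y s * G s| ≤ _
        rw [h2, abs_mul]
        calc _ ≤ |(p x s - q x s) + (q x s - q y s) + (q y s - p y s)| * 1 := by
              gcongr; exact hGb s
          _ ≤ _ := by
              have := abs_add_three (p x s - q x s) (q x s - q y s) (q y s - p y s)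
              rw [abs_sub_comm (q y s)] at this
              change _ ≤ |p x s - q x s| + |p y s - q y s| + _
              linarith
    _ = ∫ s, |p x s - q x s| ∂μ + ∫ s, |p y s - q y s| ∂μ + (Real.exp ε - Real.exp (-ε)) := by
        have i1 : Integrable (fun s => |p x s - q x s|) μ := ((hpi x).sub (hqi x)).abs
        have i2 : Integrable (fun s => |p y s - q y s|) μ := ((hpi y).sub (hqi y)).abs
        have i3 : Integrable (fun s => |p x s - q x s| + |p y s - q y s|) μ := i1.add i2
        rw [integral_add i3 (hPi.const_mul _), integral_add i1 i2, integral_const_mul, hP, mul_one]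
    _ ≤ _ := by linarith [hpq x, hpq y]

end Density

/-! ## Correlations with block indicators -/

section Block

variable {m : ℕ}

/-- The centered and scaled indicator of the event that the block `b` of a string has value
`v`. -/
def blockScore (b : Fin m) (v : Fin 16) (x : Fin m → Fin 16) : ℝ :=
  if x b = v then 15 else -1

theorem abs_blockScore_le (b : Fin m) (v : Fin 16) (x : Fin m → Fin 16) :
    |blockScore b v x| ≤ 15 := by
  unfold blockScore
  split_ifs <;> norm_num [abs_of_pos]

/-- A mean zero function of one coordinate is orthogonal to the functions that do not depend on
this coordinate. -/
theorem sum_mul_eq_zero_of_forall_add_single (b : Fin m) {g : Fin 16 → ℝ} (hg : ∑ a, g a = 0)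
    {h : (Fin m → Fin 16) → ℝ} (hh : ∀ x c, h (x + Pi.single b c) = h x) :
    ∑ x : Fin m → Fin 16, g (x b) * h x = 0 := by
  -- Shifting coordinate `b` by `c` leaves `h` unchanged; summing over all 16 shifts averages `g` to
  -- zero.
  have h1 : ∀ c : Fin 16, ∑ x : Fin m → Fin 16, g (x b) * h x =
      ∑ x : Fin m → Fin 16, g (x b + c) * h x := fun c => by
    rw [← Equiv.sum_comp (Equiv.addRight (Pi.single b c))]
    simp [hh]
  have h2 : ∑ _c : Fin 16, ∑ x : Fin m → Fin 16, g (x b) * h x = 0 := by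
    rw [Finset.sum_congr rfl fun c _ => h1 c, Finset.sum_comm]
    refine Finset.sum_eq_zero fun x _ => ?_
    have : ∑ c, g (x b + c) = 0 := (Equiv.sum_comp (Equiv.addLeft (x b)) g).trans hg
    rw [← Finset.sum_mul, this, zero_mul]
  simpa using h2

theorem sum_ite_eq_zero (v : Fin 16) : ∑ a : Fin 16, (if a = v then (15 : ℝ) else -1) = 0 := by
  have : ∀ a : Fin 16, (if a = v then (15 : ℝ) else -1) = (if a = v then 16 else 0) - 1 :=
    fun a => by split_ifs <;> norm_num
  simp only [this, Finset.sum_sub_distrib]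
  simp

theorem sum_blockScore (b : Fin m) (v : Fin 16) :
    ∑ x : Fin m → Fin 16, blockScore b v x = 0 := by
  simpa [blockScore] using
    sum_mul_eq_zero_of_forall_add_single b (sum_ite_eq_zero v) (h := fun _ => 1) (by simp)

/-- The exponent is a sum of independent mean zero terms, one per block, each of size at most `1/√m`
after scaling. So each block contributes a factor at most `1 + 1/m`, and the average exponential is
at most `e < 3`. -/
theorem sum_exp_blockScore_le (hm : 0 < m) (c : Fin m → Fin 16 → ℝ) (hc : ∀ b v, |c b v| ≤ 1) :
    ∑ x : Fin m → Fin 16,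
        Real.exp ((32 * √m)⁻¹ * ∑ b, ∑ v, c b v * blockScore b v x) ≤
      3 * Fintype.card (Fin m → Fin 16) := by
  have hm' : (0 : ℝ) < m := by exact_mod_cast hm
  have hsq : 0 < √(m : ℝ) := Real.sqrt_pos.2 hm'
  have hsq1 : 1 ≤ √(m : ℝ) := Real.one_le_sqrt.2 (by exact_mod_cast hm)
  let φ : Fin m → Fin 16 → ℝ := fun b a => ∑ v, c b v * (if a = v then 15 else -1)
  have hφ : ∀ b a, φ b a = 16 * c b a - ∑ v, c b v := by
    intro b a
    have : ∀ v, c b v * (if a = v then (15 : ℝ) else -1) =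
        16 * (if a = v then c b v else 0) - c b v := fun v => by split_ifs <;> ring
    simp only [φ, this, Finset.sum_sub_distrib, ← Finset.mul_sum]
    simp
  have hφ0 : ∀ b, ∑ a, φ b a = 0 := fun b => by
    simp [hφ, Finset.sum_sub_distrib, ← Finset.mul_sum]
  have hφ1 : ∀ b a, |φ b a| ≤ 32 := by
    intro b a
    have h1 : |∑ v, c b v| ≤ 16 := (Finset.abs_sum_le_sum_abs _ _).trans
      ((Finset.sum_le_sum fun v _ => hc b v).trans (by simp))
    have h2 := hc b a
    rw [hφ]
    rw [abs_le] at *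
    constructor <;> linarith
  set t : ℝ := (32 * √m)⁻¹ with ht
  have ht0 : 0 < t := by positivity
  have htφ : ∀ b a, |t * φ b a| ≤ (√m)⁻¹ := by
    intro b a
    rw [abs_mul, abs_of_pos ht0, ht, mul_inv, mul_comm (32⁻¹ : ℝ), mul_assoc]
    have := hφ1 b a
    exact mul_le_of_le_one_right (by positivity) (by linarith)
  have hexp : ∀ b a, Real.exp (t * φ b a) ≤ 1 + t * φ b a + (m : ℝ)⁻¹ := by
    intro b a
    have h1 : |t * φ b a| ≤ 1 := (htφ b a).trans (inv_le_one_of_one_le₀ hsq1)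
    have h2 := (abs_le.1 (Real.abs_exp_sub_one_sub_id_le h1)).2
    have h3 : (t * φ b a) ^ 2 ≤ (m : ℝ)⁻¹ := by
      have := pow_le_pow_left₀ (abs_nonneg _) (htφ b a) 2
      rwa [sq_abs, inv_pow, Real.sq_sqrt hm'.le] at this
    linarith
  calc ∑ x : Fin m → Fin 16, Real.exp (t * ∑ b, ∑ v, c b v * blockScore b v x)
      = ∑ x : Fin m → Fin 16, ∏ b, Real.exp (t * φ b (x b)) := by
        refine Finset.sum_congr rfl fun x _ => ?_
        rw [← Real.exp_sum, Finset.mul_sum]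
        rfl
    _ = ∏ b : Fin m, ∑ a, Real.exp (t * φ b a) := by
        rw [Finset.prod_univ_sum, Fintype.piFinset_univ]
    _ ≤ ∏ b : Fin m, (16 * Real.exp ((m : ℝ)⁻¹)) := by
        refine Finset.prod_le_prod (fun b _ => Finset.sum_nonneg fun a _ => (Real.exp_pos _).le)
          fun b _ => ?_
        calc ∑ a, Real.exp (t * φ b a) ≤ ∑ a, (1 + t * φ b a + (m : ℝ)⁻¹) :=
              Finset.sum_le_sum fun a _ => hexp b a
          _ = 16 * (1 + (m : ℝ)⁻¹) := by
              simp only [Finset.sum_add_distrib, ← Finset.mul_sum, hφ0]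
              simp
              ring
          _ ≤ _ := by
              have := Real.add_one_le_exp ((m : ℝ)⁻¹)
              linarith
    _ = Real.exp 1 * 16 ^ m := by
        rw [Finset.prod_const, mul_pow, ← Real.exp_nat_mul]
        simp [hm'.ne', mul_comm]
    _ ≤ _ := by
        have := Real.exp_one_lt_d9
        simp only [Fintype.card_pi, Fintype.card_fin, Finset.prod_const, Finset.card_univ]
        push_cast
        gcongr
        linarith

/-- A level-one inequality: a function that is within a factor `exp ε` of a constant has small
correlations with the block indicators. -/
theorem sum_abs_sum_blockScore_mul_le (hm : 0 < m) {ε P : ℝ} (hε : 0 < ε) (hP : 0 ≤ P)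
    (q : (Fin m → Fin 16) → ℝ)
    (hq : ∀ x, Real.exp (-ε) * P ≤ q x ∧ q x ≤ Real.exp ε * P)
    (hqs : ∑ x, q x ≤ 2 * (Fintype.card (Fin m → Fin 16) * P)) :
    ∑ b, ∑ v, |∑ x, blockScore b v x * q x| ≤
      400 * ε * √m * (Fintype.card (Fin m → Fin 16) : ℝ) * P := by
  set N : ℝ := (Fintype.card (Fin m → Fin 16) : ℝ) with hN
  have hN0 : 0 < N := by rw [hN]; exact_mod_cast Fintype.card_pos
  have hsq : 0 < √(m : ℝ) := Real.sqrt_pos.2 (by exact_mod_cast hm)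
  -- These signs turn the sum of absolute values into the correlation of `q` with the single
  -- function `F`, whose exponential moments are bounded.
  let c : Fin m → Fin 16 → ℝ := fun b v => SignType.sign (∑ x, blockScore b v x * q x)
  have hc : ∀ b v, |c b v| ≤ 1 := fun b v => by
    simp only [c]
    rcases SignType.sign (∑ x, blockScore b v x * q x) <;> simp
  let F : (Fin m → Fin 16) → ℝ := fun x => ∑ b, ∑ v, c b v * blockScore b v x
  set t : ℝ := (32 * √m)⁻¹ with ht
  have ht0 : 0 < t := by positivity
  have hF1 : ∑ x, Real.exp (t * F x) ≤ 3 * N := sum_exp_blockScore_le hm c hc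
  have hF2 : ∑ x, Real.exp (-(t * F x)) ≤ 3 * N := by
    have := sum_exp_blockScore_le hm (fun b v => -c b v) (by simpa using hc)
    simp only [neg_mul, Finset.sum_neg_distrib, mul_neg] at this
    exact this
  have hmain : ∑ b, ∑ v, |∑ x, blockScore b v x * q x| = ∑ x, F x * q x := by
    simp only [F, Finset.sum_mul]
    conv_rhs => rw [Finset.sum_comm]
    refine Finset.sum_congr rfl fun b _ => ?_
    conv_rhs => rw [Finset.sum_comm]
    refine Finset.sum_congr rfl fun v _ => ?_
    rw [← sign_mul_self (∑ x, blockScore b v x * q x), Finset.mul_sum]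
    exact Finset.sum_congr rfl fun x _ => by simp only [c]; ring
  rw [hmain]
  have hconv : ∀ B : ℝ, t * ∑ x, F x * q x ≤ B → ∑ x, F x * q x ≤ 32 * √m * B := by
    intro B hB
    rwa [ht, inv_mul_le_iff₀ (by positivity)] at hB
  rcases hP.eq_or_lt with rfl | hP
  · have : ∀ x, q x = 0 := fun x => by
      have := hq x
      simp only [mul_zero] at this
      exact le_antisymm this.2 this.1
    simp [this]
  -- For `ε ≤ 1`, `F` has mean zero and only sees `q - P`, which is at most `2 * ε * P`. For larger
  -- `ε` this would cost `exp ε`, and an entropy inequality keeps the bound linear. The constant 400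
  -- exceeds both `32 * 12` and `32 * 5`.
  rcases le_total ε 1 with h1 | h1
  · have hF0 : ∑ x, F x = 0 := by
      simp only [F]
      rw [Finset.sum_comm]
      refine Finset.sum_eq_zero fun b _ => ?_
      rw [Finset.sum_comm]
      refine Finset.sum_eq_zero fun v _ => ?_
      rw [← Finset.mul_sum]
      rw [sum_blockScore, mul_zero]
    have hexp : Real.exp ε - 1 ≤ 2 * ε := by
      have := (abs_le.1 (Real.abs_exp_sub_one_sub_id_le (abs_le.2 ⟨by linarith, h1⟩))).2
      nlinarith
    have hexp' : 1 - Real.exp (-ε) ≤ 2 * ε := by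
      have := Real.add_one_le_exp (-ε)
      linarith
    have hqP : ∀ x, |q x - P| ≤ 2 * ε * P := fun x => by
      have := hq x
      exact abs_le.2 ⟨by nlinarith, by nlinarith⟩
    have : t * ∑ x, F x * q x ≤ 12 * ε * N * P := by
      calc t * ∑ x, F x * q x = ∑ x, t * F x * (q x - P) := by
            rw [Finset.mul_sum]
            simp only [mul_sub, Finset.sum_sub_distrib, ← Finset.sum_mul, ← Finset.mul_sum, hF0]
            simp [Finset.mul_sum, mul_assoc]
        _ ≤ ∑ x, (Real.exp (t * F x) + Real.exp (-(t * F x))) * (2 * ε * P) := by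
            refine Finset.sum_le_sum fun x _ => ?_
            refine (le_abs_self _).trans ?_
            rw [abs_mul]
            have h3 := Real.add_one_le_exp (t * F x)
            have h4 := Real.add_one_le_exp (-(t * F x))
            have h5 := Real.exp_pos (t * F x)
            have h6 := Real.exp_pos (-(t * F x))
            refine mul_le_mul (abs_le.2 ⟨by linarith, by linarith⟩) (hqP x) (abs_nonneg _)
              (by positivity)
        _ = (∑ x, Real.exp (t * F x) + ∑ x, Real.exp (-(t * F x))) * (2 * ε * P) := by
            rw [← Finset.sum_mul, Finset.sum_add_distrib]
        _ ≤ (3 * N + 3 * N) * (2 * ε * P) := by gcongr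
        _ = _ := by ring
    refine (hconv _ this).trans ?_
    have : 0 ≤ √m * ε * N * P := by positivity
    linarith
  -- Young's inequality `y q ≤ q log (q/P) - q + P exp y`, where the logarithm is at most `ε`.
  · have hyoung : ∀ x, t * F x * q x ≤ ε * q x + Real.exp (t * F x) * P := by
      intro x
      have hq0 : 0 < q x := lt_of_lt_of_le (by positivity) (hq x).1
      have h2 := Real.add_one_le_exp (t * F x - Real.log (q x / P))
      rw [Real.exp_sub, Real.exp_log (by positivity)] at h2
      have h3 : Real.log (q x / P) ≤ ε := by
        rw [Real.log_le_iff_le_exp (by positivity), div_le_iff₀ hP]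
        exact (hq x).2
      have h4 := mul_le_mul_of_nonneg_right h2 hq0.le
      have h5 : Real.exp (t * F x) / (q x / P) * q x = Real.exp (t * F x) * P := by field_simp
      rw [h5] at h4
      nlinarith
    have : t * ∑ x, F x * q x ≤ 5 * ε * N * P := by
      calc t * ∑ x, F x * q x = ∑ x, t * F x * q x := by
            rw [Finset.mul_sum]
            exact Finset.sum_congr rfl fun x _ => by ring
        _ ≤ ∑ x, (ε * q x + Real.exp (t * F x) * P) := Finset.sum_le_sum fun x _ => hyoung x
        _ = ε * ∑ x, q x + (∑ x, Real.exp (t * F x)) * P := by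
            rw [Finset.sum_add_distrib, ← Finset.mul_sum, ← Finset.sum_mul]
        _ ≤ ε * (2 * (N * P)) + (3 * N) * P := by gcongr
        _ ≤ _ := by nlinarith [mul_pos hN0 hP]
    refine (hconv _ this).trans ?_
    have : 0 ≤ √m * ε * N * P := by positivity
    linarith

/-- Tests on a differentially private family of measures have small correlations with the block
indicators. -/
theorem sum_abs_sum_blockScore_mul_integral_le {S : Type u} [MeasurableSpace S] (hm : 0 < m)
    (M : (Fin m → Fin 16) → Measure S) [∀ x, IsProbabilityMeasure (M x)]
    {ε δ : ℝ} (hε : 0 < ε) (hδ : 0 ≤ δ)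
    (hM : ∀ x x' C, MeasurableSet C →
      M x C ≤ ENNReal.ofReal (Real.exp ε) * M x' C + ENNReal.ofReal δ)
    (G : Fin m → Fin 16 → S → ℝ) (hG : ∀ b v, Measurable (G b v)) (hG0 : ∀ b v s, 0 ≤ G b v s)
    (hG1 : ∀ b v s, G b v s ≤ 1) :
    ∑ b, ∑ v, |∑ x, blockScore b v x * ∫ s, G b v s ∂(M x)| ≤
      (Fintype.card (Fin m → Fin 16) : ℝ) * (400 * ε * √m + 480 * m * δ) := by
  obtain ⟨μ, p, q, P, hpi, hqi, hPi, hq, hP0, hqs, hG', hpq, hP⟩ :=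
    exists_clamped_density M hε hδ hM
  have hGb : ∀ b v s, |G b v s| ≤ 1 := fun b v s => abs_le.2 ⟨by linarith [hG0 b v s], hG1 b v s⟩
  have hmul : ∀ b v {f : S → ℝ}, Integrable f μ → Integrable (fun s => f s * G b v s) μ :=
    fun b v _ hf => hf.mul_bdd (c := 1) (hG b v).aestronglyMeasurable
      (Filter.Eventually.of_forall (hGb b v))
  have hqs' : ∀ b v, Integrable (fun s => |∑ x, blockScore b v x * q x s|) μ := fun b v =>
    (integrable_finsetSum _ fun x _ => (hqi x).const_mul _).abs
  set N : ℝ := (Fintype.card (Fin m → Fin 16) : ℝ) with hN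
  -- A test bounded by 1 collects at most the absolute value of the signed density, whichever test
  -- is used for `(b, v)`. Passing from `p` to `q` costs `15 * 2δ` per string; over the `16 m` pairs
  -- this becomes `480 m δ`.
  have hterm : ∀ b v, |∑ x, blockScore b v x * ∫ s, G b v s ∂(M x)| ≤
      ∫ s, |∑ x, blockScore b v x * q x s| ∂μ + 30 * N * δ := by
    intro b v
    have h1 : ∑ x, blockScore b v x * ∫ s, G b v s ∂(M x) =
        ∫ s, (∑ x, blockScore b v x * q x s) * G b v s ∂μ +
          ∑ x, blockScore b v x * ∫ s, (p x s - q x s) * G b v s ∂μ := by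
      have : ∀ s, (∑ x, blockScore b v x * q x s) * G b v s =
          ∑ x, blockScore b v x * (q x s * G b v s) := fun s => by
        rw [Finset.sum_mul]
        exact Finset.sum_congr rfl fun x _ => by ring
      simp only [this]
      rw [integral_finsetSum _ fun x _ => (hmul b v (hqi x)).const_mul _,
        ← Finset.sum_add_distrib]
      refine Finset.sum_congr rfl fun x _ => ?_
      have i2 : Integrable (fun s => (p x s - q x s) * G b v s) μ :=
        hmul b v ((hpi x).sub (hqi x))
      rw [integral_const_mul, ← mul_add, ← integral_add (hmul b v (hqi x)) i2, hG']
      congr 2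
      funext s
      ring
    have h2 : |∫ s, (∑ x, blockScore b v x * q x s) * G b v s ∂μ| ≤
        ∫ s, |∑ x, blockScore b v x * q x s| ∂μ := by
      refine abs_integral_le_integral_abs.trans (integral_mono (hmul b v
        (integrable_finsetSum _ fun x _ => (hqi x).const_mul _)).abs (hqs' b v) fun s => ?_)
      simp only [abs_mul]
      exact mul_le_of_le_one_right (abs_nonneg _) (hGb b v s)
    have h3 : ∀ x, |∫ s, (p x s - q x s) * G b v s ∂μ| ≤ 2 * δ := fun x => by
      refine abs_integral_le_integral_abs.trans ((integral_mono
        (hmul b v ((hpi x).sub (hqi x))).abs ((hpi x).sub (hqi x)).abs fun s => ?_).trans (hpq x))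
      simp only [abs_mul]
      exact mul_le_of_le_one_right (abs_nonneg _) (hGb b v s)
    have h4 : |∑ x, blockScore b v x * ∫ s, (p x s - q x s) * G b v s ∂μ| ≤ 30 * N * δ := by
      calc _ ≤ ∑ x : Fin m → Fin 16, 15 * (2 * δ) := by
            refine (Finset.abs_sum_le_sum_abs _ _).trans (Finset.sum_le_sum fun x _ => ?_)
            rw [abs_mul]
            exact mul_le_mul (abs_blockScore_le b v x) (h3 x) (abs_nonneg _) (by norm_num)
        _ = 30 * N * δ := by
            rw [Finset.sum_const, Finset.card_univ, nsmul_eq_mul, ← hN]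
            ring
    rw [h1]
    exact (abs_add_le _ _).trans (add_le_add h2 h4)
  calc ∑ b, ∑ v, |∑ x, blockScore b v x * ∫ s, G b v s ∂(M x)|
      ≤ ∑ b : Fin m, ∑ v : Fin 16, (∫ s, |∑ x, blockScore b v x * q x s| ∂μ + 30 * N * δ) :=
        Finset.sum_le_sum fun b _ => Finset.sum_le_sum fun v _ => hterm b v
    _ = ∫ s, ∑ b, ∑ v, |∑ x, blockScore b v x * q x s| ∂μ + 480 * m * N * δ := by
        rw [integral_finsetSum _ fun b _ => integrable_finsetSum _ fun v _ => hqs' b v]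
        simp only [integral_finsetSum _ fun v _ => hqs' _ v, Finset.sum_add_distrib]
        simp
        ring
    _ ≤ ∫ s, 400 * ε * √m * N * P s ∂μ + 480 * m * N * δ := by
        gcongr
        · exact integrable_finsetSum _ fun b _ => integrable_finsetSum _ fun v _ => hqs' b v
        · exact hPi.const_mul _
        · intro s
          exact sum_abs_sum_blockScore_mul_le hm hε (hP0 s) (fun x => q x s)
            (fun x => hq x s) (hqs s)
    _ = _ := by
        rw [integral_const_mul, hP]
        ring

end Block

/-! ## Finitely supported laws -/

section Mixture

variable {X : Type u} [MeasurableSpace X] {Y : Type v} [Fintype Y]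

/-- The law with weight `p x` at the point `e x`. -/
noncomputable def finiteLaw (e : Y → X) (p : Y → ℝ) : Measure X :=
  ∑ x, ENNReal.ofReal (p x) • Measure.dirac (e x)

theorem isProbabilityMeasure_finiteLaw (e : Y → X) {p : Y → ℝ} (hp : ∀ x, 0 ≤ p x)
    (hp1 : ∑ x, p x = 1) : IsProbabilityMeasure (finiteLaw e p) := by
  refine ⟨?_⟩
  simp only [finiteLaw, Measure.finsetSum_apply, Measure.smul_apply, measure_univ, smul_eq_mul,
    mul_one]
  rw [← ENNReal.ofReal_sum_of_nonneg fun x _ => hp x, hp1, ENNReal.ofReal_one]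

theorem finiteLaw_add (e : Y → X) {p q : Y → ℝ} (hp : ∀ x, 0 ≤ p x) (hq : ∀ x, 0 ≤ q x) {a b : ℝ}
    (ha : 0 ≤ a) (hb : 0 ≤ b) :
    finiteLaw e (fun x => a * p x + b * q x) =
      ENNReal.ofReal a • finiteLaw e p + ENNReal.ofReal b • finiteLaw e q := by
  simp only [finiteLaw, Finset.smul_sum, ← Finset.sum_add_distrib, smul_smul, ← add_smul]
  refine Finset.sum_congr rfl fun x _ => ?_
  rw [ENNReal.ofReal_add (mul_nonneg ha (hp x)) (mul_nonneg hb (hq x)), ENNReal.ofReal_mul ha,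
    ENNReal.ofReal_mul hb]

theorem finiteLaw_real_image [MeasurableSingletonClass X] {e : Y → X} (he : Function.Injective e)
    {p : Y → ℝ} (hp : ∀ x, 0 ≤ p x) (A : Finset Y) :
    (finiteLaw e p).real (e '' A) = ∑ x ∈ A, p x := by
  classical
  have hA : MeasurableSet (e '' (A : Set Y)) := (A.finite_toSet.image e).measurableSet
  have h : ∀ x, (ENNReal.ofReal (p x) • Measure.dirac (e x)) (e '' (A : Set Y)) =
      if x ∈ A then ENNReal.ofReal (p x) else 0 := fun x => by
    rw [Measure.smul_apply, Measure.dirac_apply' _ hA, smul_eq_mul]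
    by_cases hx : x ∈ A
    · rw [Set.indicator_of_mem (Set.mem_image_of_mem e hx)]
      simp [hx]
    · rw [Set.indicator_of_notMem (by simpa [he.eq_iff] using hx)]
      simp [hx]
  rw [measureReal_def, finiteLaw, Measure.finsetSum_apply, Finset.sum_congr rfl fun x _ => h x,
    Finset.sum_ite_mem, Finset.univ_inter, ← ENNReal.ofReal_sum_of_nonneg fun x _ => hp x,
    ENNReal.toReal_ofReal (Finset.sum_nonneg fun x _ => hp x)]

theorem le_tvDist (μ ν : Measure X) [IsProbabilityMeasure μ] [IsProbabilityMeasure ν] {A : Set X}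
    (hA : MeasurableSet A) : |μ.real A - ν.real A| ≤ tvDist μ ν := by
  refine le_ciSup (f := fun A : {A : Set X // MeasurableSet A} => |μ.real A.1 - ν.real A.1|)
    ⟨1, ?_⟩ ⟨A, hA⟩
  rintro _ ⟨B, rfl⟩
  have h1 : 0 ≤ μ.real B.1 := measureReal_nonneg
  have h2 : 0 ≤ ν.real B.1 := measureReal_nonneg
  have h3 : μ.real B.1 ≤ 1 := measureReal_le_one
  have h4 : ν.real B.1 ≤ 1 := measureReal_le_one
  exact abs_le.2 ⟨by linarith, by linarith⟩

theorem le_tvDist_finiteLaw [MeasurableSingletonClass X] {e : Y → X} (he : Function.Injective e)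
    {p q : Y → ℝ} (hp : ∀ x, 0 ≤ p x) (hp1 : ∑ x, p x = 1) (hq : ∀ x, 0 ≤ q x)
    (hq1 : ∑ x, q x = 1) (A : Finset Y) :
    |∑ x ∈ A, p x - ∑ x ∈ A, q x| ≤ tvDist (finiteLaw e p) (finiteLaw e q) := by
  have := isProbabilityMeasure_finiteLaw e hp hp1
  have := isProbabilityMeasure_finiteLaw e hq hq1
  rw [← finiteLaw_real_image he hp, ← finiteLaw_real_image he hq]
  exact le_tvDist _ _ (A.finite_toSet.image e).measurableSet

theorem toReal_lintegral_joinUser_finiteLaw {Ω : Type w} {Z : Type z} [MeasurableSpace Ω]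
    [MeasurableSpace Z] (R : Kernel (Ω × X) (Word Z)) [IsMarkovKernel R] (e : Y → X) {p : Y → ℝ}
    (hp : ∀ x, 0 ≤ p x) (m : Measure (Ω × Word Z))
    [∀ x, IsProbabilityMeasure (joinUser R (Measure.dirac (e x)) m)] {g : Ω × Word Z → ℝ≥0∞}
    (hg : Measurable g) (hg1 : ∀ s, g s ≤ 1) :
    (∫⁻ s, g s ∂(joinUser R (finiteLaw e p) m)).toReal =
      ∑ x, p x * ∫ s, (g s).toReal ∂(joinUser R (Measure.dirac (e x)) m) := by
  have hfin : ∀ x, ∫⁻ s, g s ∂(joinUser R (Measure.dirac (e x)) m) ≠ ∞ := fun x =>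
    ne_top_of_le_ne_top (by simp) (lintegral_mono hg1)
  rw [finiteLaw, joinUser_sum_smul]
  simp only [lintegral_finsetSum_measure, lintegral_smul_measure, smul_eq_mul]
  rw [ENNReal.toReal_sum fun x _ => ENNReal.mul_ne_top ENNReal.ofReal_ne_top (hfin x)]
  refine Finset.sum_congr rfl fun x _ => ?_
  rw [ENNReal.toReal_mul, ENNReal.toReal_ofReal (hp x), integral_toReal hg.aemeasurable
    (Filter.Eventually.of_forall fun s => (hg1 s).trans_lt ENNReal.one_lt_top)]

end Mixture

/-! ## Replacing users one at a time -/

section Hybrid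

theorem toReal_lintegral_le_one {S : Type u} [MeasurableSpace S] (m : Measure S)
    [IsProbabilityMeasure m] {g : S → ℝ≥0∞} (hg1 : ∀ s, g s ≤ 1) :
    (∫⁻ s, g s ∂m).toReal ≤ 1 := by
  refine ENNReal.toReal_mono ENNReal.one_ne_top ((lintegral_mono hg1).trans ?_)
  simp

variable {X : Type u} {O : Type v} [MeasurableSpace X] [MeasurableSpace O]
  {P : ShuffleProtocol.{u, v, w, z} X O} {n : ℕ}

/-- Replacing the law of the data of all users. -/
theorem abs_test_joinUser_pow_sub_le (ν ν' : Measure X) [IsProbabilityMeasure ν]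
    [IsProbabilityMeasure ν'] {g : P.Coins × Word P.Msg → ℝ≥0∞} {Δ : ℝ}
    (hΔ : ∀ k m, k + 1 = n → P.IsViewLaw n k m →
      |(∫⁻ s, g s ∂(joinUser (P.randomizer n) ν m)).toReal -
        (∫⁻ s, g s ∂(joinUser (P.randomizer n) ν' m)).toReal| ≤ Δ) :
    |(∫⁻ s, g s ∂((joinUser (P.randomizer n) ν ^ n) (P.emptyView n))).toReal -
      (∫⁻ s, g s ∂((joinUser (P.randomizer n) ν' ^ n) (P.emptyView n))).toReal| ≤ n * Δ := by
  set A := joinUser (P.randomizer n) ν with hA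
  set B := joinUser (P.randomizer n) ν' with hB
  have hAB : Commute A B := commute_joinUser _ _ _
  -- Hybrids with `t` users of law `ν`. By commutativity the user replaced at each step may be taken
  -- to join last, so `hΔ` is needed for `k + 1 = n` only.
  suffices h : ∀ t ≤ n, |(∫⁻ s, g s ∂((A ^ t * B ^ (n - t)) (P.emptyView n))).toReal -
      (∫⁻ s, g s ∂((B ^ n) (P.emptyView n))).toReal| ≤ t * Δ by
    simpa using h n le_rfl
  intro t ht
  induction t with
  | zero => simp
  | succ t ih =>
    have hm : P.IsViewLaw n (n - (t + 1) + t) ((A ^ t) ((B ^ (n - (t + 1))) (P.emptyView n))) := by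
      have := ((P.isViewLaw_emptyView n).joinUser_pow ν' (n - (t + 1))).joinUser_pow ν t
      rwa [zero_add] at this
    have h1 : (A ^ (t + 1) * B ^ (n - (t + 1))) (P.emptyView n) =
        A ((A ^ t) ((B ^ (n - (t + 1))) (P.emptyView n))) := by
      rw [pow_succ']
      rfl
    have h2 : (A ^ t * B ^ (n - t)) (P.emptyView n) =
        B ((A ^ t) ((B ^ (n - (t + 1))) (P.emptyView n))) := by
      rw [show n - t = (n - (t + 1)) + 1 by omega, pow_succ', ← mul_assoc,
        (hAB.pow_left t).eq]
      rfl
    have h3 := hΔ _ _ (by omega) hm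
    have h4 := ih (by omega)
    rw [h2] at h4
    rw [h1]
    push_cast
    calc _ ≤ _ := abs_sub_le _ _ _
      _ ≤ Δ + t * Δ := add_le_add h3 h4
      _ = _ := by ring

variable {m : ℕ}

/-- The uniform law on an embedded copy of the strings of length `m` over `16` letters, tilted by
`β` towards the strings whose block `b` has value `v`. -/
noncomputable def tiltedLaw (e : (Fin m → Fin 16) → X) (β : ℝ) (b : Fin m) (v : Fin 16) :
    Measure X :=
  finiteLaw e fun x => (Fintype.card (Fin m → Fin 16) : ℝ)⁻¹ * (1 + β * blockScore b v x)

/-- The uniform law on an embedded copy of the strings of length `m` over `16` letters. -/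
noncomputable def uniformLaw (e : (Fin m → Fin 16) → X) : Measure X :=
  finiteLaw e fun _ => (Fintype.card (Fin m → Fin 16) : ℝ)⁻¹

theorem tiltedWeight_nonneg {β : ℝ} (hβ : 0 ≤ β) (hβ1 : β ≤ 1) (b : Fin m) (v : Fin 16)
    (x : Fin m → Fin 16) :
    0 ≤ (Fintype.card (Fin m → Fin 16) : ℝ)⁻¹ * (1 + β * blockScore b v x) := by
  refine mul_nonneg (by positivity) ?_
  unfold blockScore
  split_ifs <;> linarith

theorem sum_tiltedWeight (β : ℝ) (b : Fin m) (v : Fin 16) :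
    ∑ x : Fin m → Fin 16, (Fintype.card (Fin m → Fin 16) : ℝ)⁻¹ * (1 + β * blockScore b v x) =
      1 := by
  rw [← Finset.mul_sum, Finset.sum_add_distrib, ← Finset.mul_sum, sum_blockScore]
  simp

theorem isProbabilityMeasure_tiltedLaw (e : (Fin m → Fin 16) → X) {β : ℝ} (hβ : 0 ≤ β)
    (hβ1 : β ≤ 1) (b : Fin m) (v : Fin 16) : IsProbabilityMeasure (tiltedLaw e β b v) :=
  isProbabilityMeasure_finiteLaw e (tiltedWeight_nonneg hβ hβ1 b v) (sum_tiltedWeight β b v)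

theorem isProbabilityMeasure_uniformLaw (e : (Fin m → Fin 16) → X) :
    IsProbabilityMeasure (uniformLaw e) :=
  isProbabilityMeasure_finiteLaw e (fun _ => by positivity) (by simp)

/-- Tilt 1 is the uniform law conditioned on block `b` having value `v`, because `1 + blockScore` is
16 times the indicator of that event. -/
theorem tiltedLaw_eq (e : (Fin m → Fin 16) → X) {β : ℝ} (hβ : 0 ≤ β) (hβ1 : β ≤ 1) (b : Fin m)
    (v : Fin 16) :
    tiltedLaw e β b v =
      ENNReal.ofReal (1 - β) • uniformLaw e + ENNReal.ofReal β • tiltedLaw e 1 b v := by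
  rw [uniformLaw, tiltedLaw, tiltedLaw, ← finiteLaw_add e (fun _ => by positivity)
    (tiltedWeight_nonneg zero_le_one le_rfl b v) (by linarith) hβ]
  congr 1
  funext x
  ring

/-- Replacing some of the users with uniform data by users with tilted data. -/
theorem sum_abs_test_tilted_sub_le (hm : 0 < m) {ε δ : ℝ} (hε : 0 < ε) (hδ : 0 ≤ δ)
    (hP : P.IsRobustlyPrivate ε δ (1 / 3)) (e : (Fin m → Fin 16) → X)
    (g : Fin m → Fin 16 → P.Coins × Word P.Msg → ℝ≥0∞) (hg : ∀ b v, Measurable (g b v))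
    (hg1 : ∀ b v s, g b v s ≤ 1) (l : ℕ) (hl : 3 * l ≤ 2 * n) :
    ∑ b, ∑ v, |(∫⁻ s, g b v s ∂((joinUser (P.randomizer n) (tiltedLaw e 1 b v) ^ l *
        joinUser (P.randomizer n) (uniformLaw e) ^ (n - l)) (P.emptyView n))).toReal -
      (∫⁻ s, g b v s ∂((joinUser (P.randomizer n) (uniformLaw e) ^ n) (P.emptyView n))).toReal| ≤
      l * (400 * ε * √m + 480 * m * δ) := by
  have := isProbabilityMeasure_uniformLaw e
  have hT := isProbabilityMeasure_tiltedLaw e zero_le_one le_rfl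
  set U := joinUser (P.randomizer n) (uniformLaw e) with hU
  induction l with
  | zero => simp
  | succ l ih =>
    set k := n - (l + 1) with hk
    set μ := (U ^ k) (P.emptyView n) with hμ
    have hview : P.IsViewLaw n k μ := by
      have := (P.isViewLaw_emptyView n).joinUser_pow (uniformLaw e) k
      rwa [zero_add] at this
    -- The replaced user and the `k` uniform users are `n - l` in number, at least a third of `n`.
    have hpriv : IsDP ε δ fun x => P.view n (k + 1) x := by
      refine hP n (k + 1) ?_ (by omega)
      have : n ≤ 3 * (k + 1) := by omega
      have : (n : ℝ) ≤ 3 * ((k + 1 : ℕ) : ℝ) := by exact_mod_cast this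
      linarith
    have hprob : ∀ x, IsProbabilityMeasure
        (joinUser (P.randomizer n) (Measure.dirac (e x)) μ) := fun x =>
      (hview.joinUser _).isProbabilityMeasure
    -- The `l` tilted users who join later are absorbed into the test. What remains of the
    -- hypothesis is the test and the law of one datum; the laws indexed by that datum are common to
    -- all `(b, v)`, so the level-one bound applies to the whole sum.
    choose G hG hG1 hGg using fun b v =>
      exists_test_joinUser_pow (P.randomizer n) (tiltedLaw e 1 b v) (hg b v) (hg1 b v) l
    have hstep : ∑ b, ∑ v, |(∫⁻ s, g b v s ∂((joinUser (P.randomizer n) (tiltedLaw e 1 b v) ^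
          (l + 1) * U ^ k) (P.emptyView n))).toReal -
        (∫⁻ s, g b v s ∂((joinUser (P.randomizer n) (tiltedLaw e 1 b v) ^ l *
          U ^ (n - l)) (P.emptyView n))).toReal| ≤ 400 * ε * √m + 480 * m * δ := by
      have h1 : ∀ b v, |(∫⁻ s, g b v s ∂((joinUser (P.randomizer n) (tiltedLaw e 1 b v) ^
            (l + 1) * U ^ k) (P.emptyView n))).toReal -
          (∫⁻ s, g b v s ∂((joinUser (P.randomizer n) (tiltedLaw e 1 b v) ^ l *
            U ^ (n - l)) (P.emptyView n))).toReal| =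
          (Fintype.card (Fin m → Fin 16) : ℝ)⁻¹ * |∑ x, blockScore b v x *
            ∫ s, (G b v s).toReal ∂(joinUser (P.randomizer n) (Measure.dirac (e x)) μ)| := by
        intro b v
        have e1 : (joinUser (P.randomizer n) (tiltedLaw e 1 b v) ^ (l + 1) * U ^ k)
            (P.emptyView n) = (joinUser (P.randomizer n) (tiltedLaw e 1 b v) ^ l)
              (joinUser (P.randomizer n) (tiltedLaw e 1 b v) μ) := by
          rw [pow_succ]
          rfl
        have e2 : (joinUser (P.randomizer n) (tiltedLaw e 1 b v) ^ l * U ^ (n - l))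
            (P.emptyView n) = (joinUser (P.randomizer n) (tiltedLaw e 1 b v) ^ l) (U μ) := by
          rw [show n - l = k + 1 by omega, pow_succ']
          rfl
        rw [e1, e2, hGg, hGg, hU, tiltedLaw, uniformLaw,
          toReal_lintegral_joinUser_finiteLaw _ e (tiltedWeight_nonneg zero_le_one le_rfl b v) μ
            (hG b v) (hG1 b v),
          toReal_lintegral_joinUser_finiteLaw _ e (fun _ => by positivity) μ (hG b v) (hG1 b v),
          ← Finset.sum_sub_distrib, ← abs_of_nonneg (show
            (0 : ℝ) ≤ (Fintype.card (Fin m → Fin 16) : ℝ)⁻¹ by positivity), ← abs_mul,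
          Finset.mul_sum, abs_of_nonneg (show
            (0 : ℝ) ≤ (Fintype.card (Fin m → Fin 16) : ℝ)⁻¹ by positivity)]
        congr 1
        refine Finset.sum_congr rfl fun x _ => ?_
        ring
      simp only [h1, ← Finset.mul_sum]
      rw [inv_mul_le_iff₀ (by exact_mod_cast Fintype.card_pos)]
      exact sum_abs_sum_blockScore_mul_integral_le hm _ hε hδ
        (fun x x' C hC => hview.joinUser_dirac_le hpriv _ _ hC)
        (fun b v s => (G b v s).toReal) (fun b v => (hG b v).ennreal_toReal)
        (fun b v s => ENNReal.toReal_nonneg)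
        (fun b v s => ENNReal.toReal_mono ENNReal.one_ne_top (hG1 b v s))
    have ih' := ih (by omega)
    push_cast
    calc _ ≤ ∑ b, ∑ v, (_ + _) := Finset.sum_le_sum fun b _ => Finset.sum_le_sum fun v _ =>
          abs_sub_le _ (∫⁻ s, g b v s ∂((joinUser (P.randomizer n) (tiltedLaw e 1 b v) ^ l *
            U ^ (n - l)) (P.emptyView n))).toReal _
      _ ≤ (400 * ε * √m + 480 * m * δ) + l * (400 * ε * √m + 480 * m * δ) := by
          simp only [Finset.sum_add_distrib]
          exact add_le_add hstep ih'
      _ = _ := by ring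

/-- The binomial theorem for commuting operators; `l` counts the users whose datum is drawn from the
fully tilted component. -/
theorem test_tilted_pow_eq (e : (Fin m → Fin 16) → X) {β : ℝ} (hβ : 0 ≤ β) (hβ1 : β ≤ 1)
    (b : Fin m) (v : Fin 16) {g : P.Coins × Word P.Msg → ℝ≥0∞} (hg1 : ∀ s, g s ≤ 1) :
    (∫⁻ s, g s ∂((joinUser (P.randomizer n) (tiltedLaw e β b v) ^ n) (P.emptyView n))).toReal =
      ∑ l ∈ Finset.range (n + 1), (n.choose l * β ^ l * (1 - β) ^ (n - l)) *
        (∫⁻ s, g s ∂((joinUser (P.randomizer n) (tiltedLaw e 1 b v) ^ l *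
          joinUser (P.randomizer n) (uniformLaw e) ^ (n - l)) (P.emptyView n))).toReal := by
  have := isProbabilityMeasure_uniformLaw e
  have := isProbabilityMeasure_tiltedLaw e zero_le_one le_rfl b v
  set U := joinUser (P.randomizer n) (uniformLaw e) with hU
  set T := joinUser (P.randomizer n) (tiltedLaw e 1 b v) with hT
  have hTU : Commute T U := commute_joinUser _ _ _
  have hfin : ∀ l, ∫⁻ s, g s ∂((T ^ l * U ^ (n - l)) (P.emptyView n)) ≠ ∞ := fun l => by
    have : IsProbabilityMeasure ((T ^ l * U ^ (n - l)) (P.emptyView n)) :=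
      (((P.isViewLaw_emptyView n).joinUser_pow (uniformLaw e) (n - l)).joinUser_pow
        (tiltedLaw e 1 b v) l).isProbabilityMeasure
    exact ne_top_of_le_ne_top (by simp) (lintegral_mono hg1)
  have hpow : (joinUser (P.randomizer n) (tiltedLaw e β b v) ^ n) (P.emptyView n) =
      ∑ l ∈ Finset.range (n + 1),
        ((n.choose l : ℝ≥0∞) * ENNReal.ofReal β ^ l * ENNReal.ofReal (1 - β) ^ (n - l)) •
          (T ^ l * U ^ (n - l)) (P.emptyView n) := by
    rw [tiltedLaw_eq e hβ hβ1, add_comm, joinUser_smul_add_smul,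
      ((hTU.smul_left _).smul_right _).add_pow, LinearMap.sum_apply]
    refine Finset.sum_congr rfl fun l _ => ?_
    rw [(Nat.cast_commute _ _).symm.eq, ← nsmul_eq_mul, smul_pow, smul_pow, smul_mul_smul_comm,
      LinearMap.smul_apply, LinearMap.smul_apply,
      ← Nat.cast_smul_eq_nsmul ℝ≥0∞, smul_smul, ← mul_assoc]
  rw [hpow, lintegral_finsetSum_measure]
  simp only [lintegral_smul_measure, smul_eq_mul]
  rw [ENNReal.toReal_sum fun l _ => ENNReal.mul_ne_top (by finiteness) (hfin l)]
  refine Finset.sum_congr rfl fun l _ => ?_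
  rw [ENNReal.toReal_mul]
  congr 1
  rw [ENNReal.toReal_mul, ENNReal.toReal_mul, ENNReal.toReal_pow, ENNReal.toReal_pow,
    ENNReal.toReal_ofReal hβ, ENNReal.toReal_ofReal (by linarith), ENNReal.toReal_natCast]

end Hybrid

/-- The mean of an affine function of a binomial variable, read off from the Bernstein polynomial
identities. -/
theorem sum_choose_mul_affine (n : ℕ) (β a c : ℝ) :
    ∑ l ∈ Finset.range (n + 1), (n.choose l * β ^ l * (1 - β) ^ (n - l)) * (a + l * c) =
      a + n * β * c := by
  have h0 := congrArg (Polynomial.eval β) (bernsteinPolynomial.sum ℝ n)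
  have h1 := congrArg (Polynomial.eval β) (bernsteinPolynomial.sum_smul ℝ n)
  simp only [Polynomial.eval_finsetSum, bernsteinPolynomial, nsmul_eq_mul, Polynomial.eval_mul,
    Polynomial.eval_natCast, Polynomial.eval_pow, Polynomial.eval_X, Polynomial.eval_sub,
    Polynomial.eval_one] at h0 h1
  calc _ = (∑ l ∈ Finset.range (n + 1), (n.choose l * β ^ l * (1 - β) ^ (n - l))) * a +
        (∑ l ∈ Finset.range (n + 1), l * (n.choose l * β ^ l * (1 - β) ^ (n - l))) * c := by
        rw [Finset.sum_mul, Finset.sum_mul, ← Finset.sum_add_distrib]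
        exact Finset.sum_congr rfl fun l _ => by ring
    _ = _ := by rw [h0, h1]; ring

/-! ## Many hypotheses -/

section Many

variable {X : Type u} [MeasurableSpace X] {m d : ℕ}

theorem le_of_tilted_success {P : ShuffleProtocol.{u, 0, w, z} X (Fin d)} {n : ℕ} (hm : 0 < m)
    (hd : 8 ≤ d) {ε δ β : ℝ} (hε : 0 < ε) (hδ : 0 ≤ δ) (hβ : 0 ≤ β) (hβ1 : β ≤ 8 / 15)
    (hP : P.IsRobustlyPrivate ε δ (1 / 3)) (e : (Fin m → Fin 16) → X)
    (σ : Fin d → Fin m × Fin 16) (hσ : Function.Injective σ)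
    (hsucc : ∀ j, 99 / 100 ≤
      (P.exec n ∘ₘ Measure.pi fun _ : Fin n => tiltedLaw e β (σ j).1 (σ j).2) {j}) :
    0.165 * d ≤ n * β * (400 * ε * √m + 480 * m * δ) := by
  set κ : ℝ := 400 * ε * √m + 480 * m * δ with hκ
  have hκ0 : 0 ≤ κ := by positivity
  have hβ1' : β ≤ 1 := by linarith
  have hd' : (8 : ℝ) ≤ d := by exact_mod_cast hd
  have hprobT := isProbabilityMeasure_tiltedLaw e zero_le_one le_rfl
  have hprobQ := isProbabilityMeasure_tiltedLaw e hβ hβ1'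
  have := isProbabilityMeasure_uniformLaw e
  -- Pairs that encode no hypothesis have an empty preimage and get the zero test.
  let g : Fin m → Fin 16 → P.Coins × Word P.Msg → ℝ≥0∞ := fun b v s =>
    P.analyzer n s (σ ⁻¹' {(b, v)})
  have hg : ∀ b v, Measurable (g b v) := fun b v =>
    Kernel.measurable_coe _ (MeasurableSet.of_discrete)
  have hg1 : ∀ b v s, g b v s ≤ 1 := fun b v s => prob_le_one
  have hgσ : ∀ j s, g (σ j).1 (σ j).2 s = P.analyzer n s {j} := fun j s => by
    have : σ ⁻¹' {((σ j).1, (σ j).2)} = {j} := by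
      ext i
      simp [hσ.eq_iff]
    simp only [g, this]
  set U := joinUser (P.randomizer n) (uniformLaw e) with hU
  let T : Fin d → Module.End ℝ≥0∞ (Measure (P.Coins × Word P.Msg)) := fun j =>
    joinUser (P.randomizer n) (tiltedLaw e 1 (σ j).1 (σ j).2)
  let H : ℕ → Fin d → ℝ := fun l j =>
    (∫⁻ s, g (σ j).1 (σ j).2 s ∂((T j ^ l * U ^ (n - l)) (P.emptyView n))).toReal
  let H₀ : Fin d → ℝ := fun j => (∫⁻ s, g (σ j).1 (σ j).2 s ∂((U ^ n) (P.emptyView n))).toReal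
  have hlaw : ∀ l j, IsProbabilityMeasure ((T j ^ l * U ^ (n - l)) (P.emptyView n)) := fun l j =>
    (((P.isViewLaw_emptyView n).joinUser_pow (uniformLaw e) (n - l)).joinUser_pow
      (tiltedLaw e 1 (σ j).1 (σ j).2) l).isProbabilityMeasure
  have hH1 : ∀ l j, H l j ≤ 1 := fun l j => toReal_lintegral_le_one _ (hg1 _ _)
  -- Under one common law of the data, the probabilities of the different outputs sum to at most 1.
  have hH₀ : ∑ j, H₀ j ≤ 1 := by
    have : IsProbabilityMeasure ((U ^ n) (P.emptyView n)) :=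
      ((P.isViewLaw_emptyView n).joinUser_pow (uniformLaw e) n).isProbabilityMeasure
    rw [← ENNReal.toReal_sum fun j _ => ne_top_of_le_ne_top (by simp) (lintegral_mono (hg1 _ _)),
      ← lintegral_finsetSum _ fun j _ => hg _ _]
    refine toReal_lintegral_le_one _ fun s => ?_
    simp only [hgσ]
    rw [sum_measure_singleton]
    exact prob_le_one
  have hgood : ∀ l, 3 * l ≤ 2 * n → ∑ j, H l j ≤ 1 + l * κ := by
    intro l hl
    have h := sum_abs_test_tilted_sub_le hm hε hδ hP e g hg hg1 l hl
    let D : Fin m × Fin 16 → ℝ := fun p => |(∫⁻ s, g p.1 p.2 s ∂((joinUser (P.randomizer n)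
      (tiltedLaw e 1 p.1 p.2) ^ l * U ^ (n - l)) (P.emptyView n))).toReal -
      (∫⁻ s, g p.1 p.2 s ∂((U ^ n) (P.emptyView n))).toReal|
    have h2 : ∑ j, |H l j - H₀ j| ≤ l * κ :=
      calc ∑ j, |H l j - H₀ j| = ∑ p ∈ Finset.univ.map ⟨σ, hσ⟩, D p :=
            (Finset.sum_map Finset.univ ⟨σ, hσ⟩ D).symm
        _ ≤ ∑ p, D p := Finset.sum_le_sum_of_subset_of_nonneg (Finset.subset_univ _)
            fun _ _ _ => abs_nonneg _
        _ = ∑ b, ∑ v, D (b, v) := Fintype.sum_prod_type D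
        _ ≤ l * κ := h
    calc ∑ j, H l j ≤ ∑ j, (H₀ j + |H l j - H₀ j|) :=
          Finset.sum_le_sum fun j _ => by linarith [le_abs_self (H l j - H₀ j)]
      _ ≤ _ := by
          rw [Finset.sum_add_distrib]
          linarith
  -- Beyond `2n/3` tilted users only the trivial bound `d` is left. Since `3l/(2n) ≥ 1` there, one
  -- affine function of `l` dominates both regimes, and its binomial mean is explicit.
  have hall : ∀ l ∈ Finset.range (n + 1),
      ∑ j, H l j ≤ 1 + l * (κ + (d - 1) * (3 / (2 * n))) := by
    intro l hl
    have hln : l ≤ n := Nat.lt_succ_iff.1 (Finset.mem_range.1 hl)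
    by_cases h : 3 * l ≤ 2 * n
    · refine (hgood l h).trans ?_
      have : 0 ≤ ((d : ℝ) - 1) * (3 / (2 * n)) := mul_nonneg (by linarith) (by positivity)
      have : 0 ≤ (l : ℝ) * (((d : ℝ) - 1) * (3 / (2 * n))) := by positivity
      linarith
    · push Not at h
      have hn : (0 : ℝ) < n := by exact_mod_cast (by omega : 0 < n)
      have h1 : 1 ≤ (l : ℝ) * (3 / (2 * n)) := by
        rw [← mul_div_assoc, one_le_div (by positivity)]
        have : (2 * n : ℝ) < 3 * l := by exact_mod_cast h
        linarith
      have h2 : ∑ j, H l j ≤ d :=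
        (Finset.sum_le_sum fun j _ => hH1 l j).trans (by simp)
      have h3 := mul_le_mul_of_nonneg_left h1 (by linarith : (0 : ℝ) ≤ d - 1)
      have h4 : 0 ≤ (l : ℝ) * κ := by positivity
      linarith
  have hsum : 99 / 100 * (d : ℝ) ≤ ∑ l ∈ Finset.range (n + 1),
      (n.choose l * β ^ l * (1 - β) ^ (n - l)) * ∑ j, H l j := by
    have h1 : ∀ j, 99 / 100 ≤ ∑ l ∈ Finset.range (n + 1),
        (n.choose l * β ^ l * (1 - β) ^ (n - l)) * H l j := fun j => by
      have h := hsucc j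
      rw [P.exec_comp_pi_apply n _ (MeasurableSet.singleton j)] at h
      have hQ : IsProbabilityMeasure ((joinUser (P.randomizer n)
          (tiltedLaw e β (σ j).1 (σ j).2) ^ n) (P.emptyView n)) :=
        ((P.isViewLaw_emptyView n).joinUser_pow _ n).isProbabilityMeasure
      simp only [← hgσ] at h
      have h' := ENNReal.toReal_mono
        (ne_top_of_le_ne_top (by simp) (lintegral_mono (hg1 _ _))) h
      rw [test_tilted_pow_eq e hβ hβ1' _ _ (hg1 _ _)] at h'
      convert h' using 1
      norm_num
    calc 99 / 100 * (d : ℝ) = ∑ j : Fin d, (99 / 100 : ℝ) := by simp [mul_comm]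
      _ ≤ _ := Finset.sum_le_sum fun j _ => h1 j
      _ = _ := by
          rw [Finset.sum_comm]
          simp only [Finset.mul_sum]
  have hfin := hsum.trans (Finset.sum_le_sum fun l hl => mul_le_mul_of_nonneg_left (hall l hl)
    (by have : 0 ≤ 1 - β := by linarith
        positivity))
  rw [sum_choose_mul_affine] at hfin
  -- As `β ≤ 8/15`, the trivial regime costs at most `0.8 (d - 1)`. What remains, `0.99 d - 1 - 0.8
  -- (d - 1)`, is at least `0.165 d` exactly when `d ≥ 8`.
  have h5 : (n : ℝ) * β * (3 / (2 * n)) ≤ 3 / 2 * β := by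
    rcases Nat.eq_zero_or_pos n with rfl | hn
    · simpa using hβ
    · have : (0 : ℝ) < n := by exact_mod_cast hn
      exact le_of_eq (by field_simp)
  have h6 := mul_le_mul_of_nonneg_left h5 (by linarith : (0 : ℝ) ≤ d - 1)
  nlinarith

/-- Compared with the uniform law, the event that block `b` has value `v` gains `15/16 * β = α`
under the first law and gains nothing under the second. -/
theorem isSeparated_tiltedLaw [MeasurableSingletonClass X] {e : (Fin m → Fin 16) → X}
    (he : Function.Injective e) {α : ℝ} (hα : 0 < α) (hα1 : α < 1 / 2) {b b' : Fin m}
    {v v' : Fin 16} (h : (b, v) ≠ (b', v')) :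
    α ≤ tvDist (tiltedLaw e (16 / 15 * α) b v) (tiltedLaw e (16 / 15 * α) b' v') := by
  set N : ℝ := (Fintype.card (Fin m → Fin 16) : ℝ) with hN
  have hN0 : 0 < N := by rw [hN]; exact_mod_cast Fintype.card_pos
  have hβ : 0 ≤ 16 / 15 * α := by linarith
  have hβ1 : 16 / 15 * α ≤ 1 := by linarith
  let A : Finset (Fin m → Fin 16) := {x | x b = v}
  have h1 : ∑ x ∈ A, blockScore b v x = 15 / 16 * N := by
    have h2 : ∀ x : Fin m → Fin 16, (if x b = v then blockScore b v x else 0) =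
        15 / 16 * (1 + blockScore b v x) := fun x => by
      unfold blockScore
      split_ifs <;> norm_num
    rw [Finset.sum_filter]
    simp only [h2, ← Finset.mul_sum, Finset.sum_add_distrib, sum_blockScore]
    simp [hN]
  have h2 : ∑ x ∈ A, blockScore b' v' x ≤ 0 := by
    by_cases hb : b = b'
    · subst hb
      refine Finset.sum_nonpos fun x hx => ?_
      have hx' : x b = v := (Finset.mem_filter.1 hx).2
      have hv : v ≠ v' := fun hv => h (by rw [hv])
      simp [blockScore, hx', hv]
    · rw [Finset.sum_filter]
      have := sum_mul_eq_zero_of_forall_add_single b' (sum_ite_eq_zero v')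
        (h := fun x => if x b = v then 1 else 0) (fun x c => by simp [hb])
      refine le_of_eq (Eq.trans (Finset.sum_congr rfl fun x _ => ?_) this)
      simp [blockScore]
  refine le_trans ?_ ((le_abs_self _).trans (le_tvDist_finiteLaw he
    (tiltedWeight_nonneg hβ hβ1 b v) (sum_tiltedWeight _ b v) (tiltedWeight_nonneg hβ hβ1 b' v')
    (sum_tiltedWeight _ b' v') A))
  rw [← Finset.sum_sub_distrib]
  have h3 : ∀ x : Fin m → Fin 16, N⁻¹ * (1 + 16 / 15 * α * blockScore b v x) -
      N⁻¹ * (1 + 16 / 15 * α * blockScore b' v' x) =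
      N⁻¹ * (16 / 15 * α) * (blockScore b v x - blockScore b' v' x) := fun x => by ring
  simp only [← hN, h3, ← Finset.mul_sum, Finset.sum_sub_distrib, h1]
  calc α = N⁻¹ * (16 / 15 * α) * (15 / 16 * N) := by field_simp
    _ ≤ _ := by
        gcongr
        linarith

end Many

/-! ## Few hypotheses -/

section Few

variable {X : Type u} [MeasurableSpace X] {K : ℕ}

/-- The weights of the uniform distribution on `K` points, a fraction `β` of which is moved to
the point `i` (nothing is moved if there is no such point). -/
noncomputable def spikeWeight (K : ℕ) (β : ℝ) (i : ℕ) (x : Fin K) : ℝ :=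
  if i < K then (1 - β) * (K : ℝ)⁻¹ + β * (if x.1 = i then 1 else 0) else (K : ℝ)⁻¹

theorem spikeWeight_nonneg {β : ℝ} (hβ : 0 ≤ β) (hβ1 : β ≤ 1) (i : ℕ) (x : Fin K) :
    0 ≤ spikeWeight K β i x := by
  have : 0 ≤ 1 - β := by linarith
  unfold spikeWeight
  split_ifs <;> positivity

theorem sum_ite_val_eq {i : ℕ} (hi : i < K) :
    ∑ x : Fin K, (if x.1 = i then (1 : ℝ) else 0) = 1 := by
  have : ∀ x : Fin K, (x.1 = i) = (x = ⟨i, hi⟩) := fun x => by simp [Fin.ext_iff]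
  simp [this]

theorem sum_spikeWeight (hK : 0 < K) (β : ℝ) (i : ℕ) : ∑ x, spikeWeight K β i x = 1 := by
  have hK' : (K : ℝ) ≠ 0 := by positivity
  unfold spikeWeight
  split_ifs with h
  · rw [Finset.sum_add_distrib, ← Finset.mul_sum _ _ β, sum_ite_val_eq h]
    simp
    field_simp
    ring
  · simp [hK']

/-- At a spiked point the weights differ by `β` from another spike and by `β (1 - 1/K) ≥ β/2` from
the uniform law, which is the index `K`. Hence `β = 2α`. -/
theorem isSeparated_spikeWeight [MeasurableSingletonClass X] {e : Fin K → X}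
    (he : Function.Injective e) (hK : 2 ≤ K) {α : ℝ} (hα : 0 < α) (hα1 : α < 1 / 2) {i j : ℕ}
    (hi : i ≤ K) (hj : j ≤ K) (hij : i ≠ j) :
    α ≤ tvDist (finiteLaw e (spikeWeight K (2 * α) i)) (finiteLaw e (spikeWeight K (2 * α) j)) := by
  have hβ : 0 ≤ 2 * α := by linarith
  have hβ1 : 2 * α ≤ 1 := by linarith
  have hK' : (2 : ℝ) ≤ K := by exact_mod_cast hK
  have hKi : (K : ℝ)⁻¹ ≤ 2⁻¹ := inv_anti₀ (by norm_num) hK'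
  have key : ∀ i j : ℕ, i < K → i ≠ j → ∀ x : Fin K, x.1 = i →
      α ≤ spikeWeight K (2 * α) i x - spikeWeight K (2 * α) j x := by
    intro i j hi hij x hx
    have hxj : x.1 ≠ j := hx ▸ hij
    unfold spikeWeight
    rw [if_pos hi, if_pos hx, if_neg hxj]
    split_ifs <;> nlinarith
  have hbound := fun x : Fin K => le_tvDist_finiteLaw he (spikeWeight_nonneg hβ hβ1 i)
    (sum_spikeWeight (by omega) (2 * α) i) (spikeWeight_nonneg hβ hβ1 j)
    (sum_spikeWeight (by omega) (2 * α) j) {x}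
  simp only [Finset.sum_singleton] at hbound
  rcases hi.lt_or_eq with h | h
  · exact ((key i j h hij ⟨i, h⟩ rfl).trans (le_abs_self _)).trans (hbound ⟨i, h⟩)
  · have hj' : j < K := by omega
    refine ((key j i hj' hij.symm ⟨j, hj'⟩ rfl).trans ?_).trans (hbound ⟨j, hj'⟩)
    rw [abs_sub_comm]
    exact le_abs_self _

/-- Two-point method: two spiked laws differ only in a fraction `β` of a user's data, so replacing
one user moves the probability of output `i` by at most `β` times the privacy bound. The `n`
replacements must move it from at most `1/100` to at least `99/100`. -/
theorem le_of_spike_success {d : ℕ} {P : ShuffleProtocol.{u, 0, w, z} X (Fin d)} {n : ℕ}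
    (hK : 2 ≤ K) {ε δ β : ℝ} (hε : 0 < ε) (hδ : 0 ≤ δ) (hβ : 0 ≤ β) (hβ1 : β ≤ 1)
    (hP : P.IsRobustlyPrivate ε δ (1 / 3)) (e : Fin K → X) {i j : Fin d} (hij : i ≠ j)
    (hi : i.1 < K) (hj : j.1 < K)
    (hsi : 99 / 100 ≤
      (P.exec n ∘ₘ Measure.pi fun _ : Fin n => finiteLaw e (spikeWeight K β i)) {i})
    (hsj : 99 / 100 ≤
      (P.exec n ∘ₘ Measure.pi fun _ : Fin n => finiteLaw e (spikeWeight K β j)) {j}) :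
    98 / 100 ≤ n * (β * min 1 (Real.exp ε - Real.exp (-ε) + 4 * δ)) := by
  have : Nonempty (Fin K) := ⟨⟨i, hi⟩⟩
  have hprob := fun i : ℕ => isProbabilityMeasure_finiteLaw e (spikeWeight_nonneg hβ hβ1 i)
    (sum_spikeWeight (by omega) β i)
  let g : P.Coins × Word P.Msg → ℝ≥0∞ := fun s => P.analyzer n s {i}
  have hg : Measurable g := Kernel.measurable_coe _ (MeasurableSet.singleton i)
  have hg1 : ∀ s, g s ≤ 1 := fun s => prob_le_one
  have hstep : ∀ k m, k + 1 = n → P.IsViewLaw n k m →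
      |(∫⁻ s, g s ∂(joinUser (P.randomizer n) (finiteLaw e (spikeWeight K β i)) m)).toReal -
        (∫⁻ s, g s ∂(joinUser (P.randomizer n) (finiteLaw e (spikeWeight K β j)) m)).toReal| ≤
        β * min 1 (Real.exp ε - Real.exp (-ε) + 4 * δ) := by
    intro k m hk hm
    have hpriv : IsDP ε δ fun x => P.view n (k + 1) x := by
      refine hP n (k + 1) ?_ hk.le
      rw [hk]
      have : (0 : ℝ) ≤ n := by positivity
      linarith
    have hdir : ∀ x, IsProbabilityMeasure
        (joinUser (P.randomizer n) (Measure.dirac (e x)) m) := fun x =>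
      (hm.joinUser _).isProbabilityMeasure
    let I : Fin K → ℝ := fun x =>
      ∫ s, (g s).toReal ∂(joinUser (P.randomizer n) (Measure.dirac (e x)) m)
    have hI0 : ∀ x, 0 ≤ I x := fun x => integral_nonneg fun s => ENNReal.toReal_nonneg
    have hgr1 : ∀ s, (g s).toReal ≤ 1 := fun s => ENNReal.toReal_mono ENNReal.one_ne_top (hg1 s)
    have hI1 : ∀ x, I x ≤ 1 := fun x => by
      have := integral_mono_of_nonneg (μ := joinUser (P.randomizer n) (Measure.dirac (e x)) m)
        (Filter.Eventually.of_forall fun s => ENNReal.toReal_nonneg (a := g s))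
        (integrable_const (1 : ℝ)) (Filter.Eventually.of_forall hgr1)
      simpa using this
    have hval : ∀ i : ℕ, ∀ hi : i < K, ∑ x, spikeWeight K β i x * I x =
        (1 - β) * (K : ℝ)⁻¹ * ∑ x, I x + β * I ⟨i, hi⟩ := by
      intro i hi
      have : ∀ x : Fin K, spikeWeight K β i x * I x =
          (1 - β) * (K : ℝ)⁻¹ * I x + β * (if x = ⟨i, hi⟩ then I x else 0) := fun x => by
        simp only [spikeWeight, if_pos hi, Fin.ext_iff]
        split_ifs <;> ring
      simp only [this, Finset.sum_add_distrib, ← Finset.mul_sum]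
      simp
    rw [toReal_lintegral_joinUser_finiteLaw _ e (spikeWeight_nonneg hβ hβ1 i) m hg hg1,
      toReal_lintegral_joinUser_finiteLaw _ e (spikeWeight_nonneg hβ hβ1 j) m hg hg1]
    change |∑ x, spikeWeight K β i x * I x - ∑ x, spikeWeight K β j x * I x| ≤ _
    rw [hval i hi, hval j hj, add_sub_add_left_eq_sub, ← mul_sub, abs_mul, abs_of_nonneg hβ]
    gcongr
    refine le_min (abs_le.2 ⟨?_, ?_⟩) ?_
    · linarith [hI0 ⟨i, hi⟩, hI1 ⟨j, hj⟩]
    · linarith [hI1 ⟨i, hi⟩, hI0 ⟨j, hj⟩]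
    · exact abs_integral_sub_integral_le
        (fun x => joinUser (P.randomizer n) (Measure.dirac (e x)) m) hε hδ
        (fun x x' C hC => hm.joinUser_dirac_le hpriv _ _ hC) hg.ennreal_toReal
        (fun s => ENNReal.toReal_nonneg) hgr1 _ _
  have h := abs_test_joinUser_pow_sub_le _ _ hstep
  have hview := fun i : ℕ => ((P.isViewLaw_emptyView n).joinUser_pow
    (finiteLaw e (spikeWeight K β i)) n).isProbabilityMeasure
  rw [P.exec_comp_pi_apply n _ (MeasurableSet.singleton _)] at hsi hsj
  have h1 : (99 / 100 : ℝ) ≤ (∫⁻ s, g s ∂((joinUser (P.randomizer n)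
      (finiteLaw e (spikeWeight K β i)) ^ n) (P.emptyView n))).toReal := by
    have := ENNReal.toReal_mono (ne_top_of_le_ne_top (by simp) (lintegral_mono hg1)) hsi
    convert this using 1
    norm_num
  have h2 : (∫⁻ s, g s ∂((joinUser (P.randomizer n)
      (finiteLaw e (spikeWeight K β j)) ^ n) (P.emptyView n))).toReal + 99 / 100 ≤ 1 := by
    have hg' : ∀ s, P.analyzer n s {j} ≤ 1 := fun s => prob_le_one
    have h3 := ENNReal.toReal_mono (ne_top_of_le_ne_top (by simp) (lintegral_mono hg')) hsj
    have h4 : ∀ s, g s + P.analyzer n s {j} ≤ 1 := fun s => by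
      simp only [g]
      rw [← measure_union (by simpa using hij) (MeasurableSet.singleton j)]
      exact prob_le_one
    have h5 := toReal_lintegral_le_one ((joinUser (P.randomizer n)
      (finiteLaw e (spikeWeight K β j)) ^ n) (P.emptyView n)) h4
    rw [lintegral_add_left hg, ENNReal.toReal_add
      (ne_top_of_le_ne_top (by simp) (lintegral_mono hg1))
      (ne_top_of_le_ne_top (by simp) (lintegral_mono hg'))] at h5
    norm_num at h3 ⊢
    linarith
  linarith [le_abs_self ((∫⁻ s, g s ∂((joinUser (P.randomizer n)
      (finiteLaw e (spikeWeight K β i)) ^ n) (P.emptyView n))).toReal - (∫⁻ s, g s ∂((joinUser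
      (P.randomizer n) (finiteLaw e (spikeWeight K β j)) ^ n) (P.emptyView n))).toReal)]

end Few

/-! ### Choice of parameters and conclusion -/

theorem exists_injective_of_le_card {X : Type u} {Y : Type v} [Fintype Y] {N : ℕ}
    (hN : (N : ℕ∞) ≤ ENat.card X) (hY : Fintype.card Y ≤ N) :
    ∃ e : Y → X, Function.Injective e := by
  rcases finite_or_infinite X with hX | hX
  · have := Fintype.ofFinite X
    rw [ENat.card_eq_coe_fintype_card, Nat.cast_le] at hN
    obtain ⟨e⟩ := Function.Embedding.nonempty_of_card_le (hY.trans hN)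
    exact ⟨e, e.injective⟩
  · exact ⟨fun y => Infinite.natEmbedding X (Fintype.equivFin Y y),
      (Infinite.natEmbedding X).injective.comp (Fin.val_injective.comp (Equiv.injective _))⟩

/-- Since `d / δ ≥ 2`, the logarithm is at least `log 2 > 0.6`; no more of it is needed. -/
theorem delta_le_of_mul_log_le {d : ℕ} (hd : 2 ≤ d) {δ B : ℝ} (hδ : 0 ≤ δ) (hδ1 : δ ≤ 1)
    (h : δ * Real.log (d / δ) ≤ 1 / 100 * B) : δ ≤ B / 60 := by
  rcases hδ.eq_or_lt with rfl | hδ0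
  · simp only [zero_mul] at h
    linarith
  have hd' : (2 : ℝ) ≤ d := by exact_mod_cast hd
  have h1 : Real.log 2 ≤ Real.log (d / δ) := by
    refine Real.log_le_log (by norm_num) ?_
    rw [le_div_iff₀ hδ0]
    nlinarith
  have h2 := Real.log_two_gt_d9
  nlinarith

theorem tester_bound_of_eight_le {d : ℕ} (hd : 8 ≤ d) {X : Type u} [MeasurableSpace X]
    [MeasurableSingletonClass X] (hX : ((2 ^ (d / 2) : ℕ) : ℕ∞) ≤ ENat.card X) {α ε δ : ℝ}
    (hα : 0 < α) (hα1 : α < 1 / 2) (hε : 0 < ε) (hδ : 0 ≤ δ)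
    (hδB : δ ≤ α ^ 2 * ε ^ 2 / d / 60) {n : ℕ}
    (T : ShuffleTester.{u, w, z} X d) (hT : T.IsRobustlyPrivate α ε δ (1 / 3))
    (hS : T.Solves α n) : √d ≤ 2000 * n * (α * ε) := by
  -- One block is four bits: `16 ^ m ≤ 2 ^ (d / 2)` strings fit into `X`, and `16 * m ≥ d` pairs
  -- suffice to index the hypotheses because `d ≥ 8`.
  set m := d / 2 / 4 with hm
  have hm0 : 0 < m := by omega
  obtain ⟨e, he⟩ := exists_injective_of_le_card (Y := Fin m → Fin 16) hX (by
    simp only [Fintype.card_pi, Fintype.card_fin, Finset.prod_const, Finset.card_univ]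
    calc 16 ^ m = 2 ^ (4 * m) := by rw [pow_mul]; norm_num
      _ ≤ 2 ^ (d / 2) := Nat.pow_le_pow_right (by norm_num) (by omega))
  obtain ⟨σ⟩ := Function.Embedding.nonempty_of_card_le (α := Fin d) (β := Fin m × Fin 16) (by
    simp only [Fintype.card_prod, Fintype.card_fin]
    omega)
  have hprob := isProbabilityMeasure_tiltedLaw e (β := 16 / 15 * α) (by linarith) (by linarith)
  let Q : Fin d → ProbabilityMeasure X := fun j =>
    ⟨tiltedLaw e (16 / 15 * α) (σ j).1 (σ j).2, hprob _ _⟩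
  have hQ : IsSeparated α Q := fun i j hij =>
    isSeparated_tiltedLaw he hα hα1 (σ.injective.ne hij)
  have h := le_of_tilted_success (P := T Q) hm0 hd hε hδ (by linarith) (by linarith) (hT Q hQ) e σ
    σ.injective (hS Q hQ)
  have hd0 : (0 : ℝ) < d := by exact_mod_cast (by omega : 0 < d)
  -- If `α ε > √d`, then `n ≥ 1` already gives the bound. Otherwise `α² ε² ≤ α ε √d`, which makes
  -- the contribution of `δ` at most `ε √d`.
  rcases lt_or_ge √(d : ℝ) (α * ε) with hlarge | hsmall
  · have hn : 1 ≤ n := Nat.one_le_iff_ne_zero.2 fun hn => by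
      subst hn
      norm_num at h
      linarith
    have hn' : (1 : ℝ) ≤ n := by exact_mod_cast hn
    nlinarith [mul_pos hα hε]
  have hmd : (8 : ℝ) * m ≤ d := by exact_mod_cast (by omega : 8 * m ≤ d)
  have hs0 : 0 < √(d : ℝ) := Real.sqrt_pos.2 hd0
  have hs2 : √(d : ℝ) * √d = d := Real.mul_self_sqrt hd0.le
  have hsm : √(m : ℝ) ≤ √d / 2 := by
    refine Real.sqrt_le_iff.2 ⟨by positivity, ?_⟩
    nlinarith
  have hdδ : 60 * (d * δ) ≤ ε * √d := by
    have h1 : d * δ * 60 ≤ α ^ 2 * ε ^ 2 := by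
      rw [div_div, le_div_iff₀ (by positivity)] at hδB
      linarith
    have h2 : α ^ 2 * ε ^ 2 ≤ α * ε * √d := by
      have := mul_le_mul_of_nonneg_left hsmall (by positivity : 0 ≤ α * ε)
      nlinarith
    have h3 : α * (ε * √d) ≤ 1 * (ε * √d) := by gcongr; linarith
    linarith
  have hκ : 400 * ε * √m + 480 * m * δ ≤ 201 * (ε * √d) := by
    have h1 : 400 * ε * √m ≤ 400 * ε * (√d / 2) := by gcongr
    have h2 : 480 * m * δ ≤ 60 * (d * δ) := by nlinarith
    linarith
  have h1 := mul_le_mul_of_nonneg_left hκ (by positivity : (0 : ℝ) ≤ n * (16 / 15 * α))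
  have h2 : 0.165 * (√(d : ℝ) * √d) ≤ (n * (16 / 15 * α) * 201 * ε) * √d := by
    rw [hs2]
    linarith
  rw [← mul_assoc] at h2
  have h3 := le_of_mul_le_mul_right h2 hs0
  have h4 : 0 ≤ (n : ℝ) * (α * ε) := by positivity
  norm_num at h3
  linarith

theorem tester_bound_of_lt_eight {d : ℕ} (hd : 2 ≤ d) (hd8 : d < 8) {X : Type u}
    [MeasurableSpace X] [MeasurableSingletonClass X]
    (hX : ((2 ^ (d / 2) : ℕ) : ℕ∞) ≤ ENat.card X) {α ε δ : ℝ} (hα : 0 < α) (hα1 : α < 1 / 2)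
    (hε : 0 < ε) (hδ : 0 ≤ δ) (hδB : δ ≤ α ^ 2 * ε ^ 2 / d / 60) {n : ℕ}
    (T : ShuffleTester.{u, w, z} X d) (hT : T.IsRobustlyPrivate α ε δ (1 / 3))
    (hS : T.Solves α n) : √d ≤ 2000 * n * (α * ε) := by
  obtain ⟨K, hK⟩ : ∃ K, K = 2 ^ (d / 2) := ⟨_, rfl⟩
  -- For `d = 3` and `d = 5` the `K` spikes are one too few, and the uniform law serves as the last
  -- hypothesis.
  have hdK : d ≤ K + 1 ∧ 2 ≤ K := by
    interval_cases d <;> simp at hK <;> omega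
  obtain ⟨e, he⟩ := exists_injective_of_le_card (Y := Fin K) hX (by simp [hK])
  have hβ : 0 ≤ 2 * α := by linarith
  have hβ1 : 2 * α ≤ 1 := by linarith
  let Q : Fin d → ProbabilityMeasure X := fun j =>
    ⟨finiteLaw e (spikeWeight K (2 * α) j), isProbabilityMeasure_finiteLaw e
      (spikeWeight_nonneg hβ hβ1 j) (sum_spikeWeight (by omega) _ _)⟩
  have hQ : IsSeparated α Q := fun i j hij =>
    isSeparated_spikeWeight he hdK.2 hα hα1 (by omega) (by omega) (Fin.val_injective.ne hij)
  have h := le_of_spike_success (P := T Q) hdK.2 hε hδ hβ hβ1 (hT Q hQ) e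
    (i := ⟨0, by omega⟩) (j := ⟨1, by omega⟩) (by simp) (by simp; omega) (by simp; omega)
    (hS Q hQ _) (hS Q hQ _)
  have hd0 : (2 : ℝ) ≤ d := by exact_mod_cast hd
  have hsd : √(d : ℝ) ≤ 3 := by
    rw [Real.sqrt_le_iff]
    have : (d : ℝ) < 8 := by exact_mod_cast hd8
    exact ⟨by norm_num, by linarith⟩
  -- For `ε ≤ 1` the exponentials contribute at most `3 ε` and `δ ≤ ε / 60`; for `ε ≥ 1` the trivial
  -- bound 1 is enough.
  have hmin : min 1 (Real.exp ε - Real.exp (-ε) + 4 * δ) ≤ 4 * ε := by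
    rcases le_total ε 1 with h1 | h1
    · refine (min_le_right _ _).trans ?_
      have h2 := (abs_le.1 (Real.abs_exp_sub_one_sub_id_le (abs_le.2 ⟨by linarith, h1⟩))).2
      have h3 := Real.add_one_le_exp (-ε)
      have h4 : δ ≤ ε / 60 := by
        refine hδB.trans ?_
        gcongr
        rw [div_le_iff₀ (by linarith)]
        have h5 : α ^ 2 * ε ^ 2 ≤ 1 * ε := by
          refine mul_le_mul (by nlinarith) (by nlinarith) (by positivity) (by norm_num)
        nlinarith
      nlinarith
    · exact (min_le_left _ _).trans (by linarith)
  have h1 : (n : ℝ) * (2 * α * min 1 (Real.exp ε - Real.exp (-ε) + 4 * δ)) ≤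
      n * (2 * α * (4 * ε)) := by gcongr
  have h2 : 0 ≤ (n : ℝ) * (α * ε) := by positivity
  linarith

theorem mainTheorem10 :
    ∃ c > (0 : ℝ), ∃ C > (0 : ℝ),
      ∀ (d : ℕ), 2 ≤ d →
      ∀ (X : Type u) [MeasurableSpace X] [MeasurableSingletonClass X],
        ((2 ^ (d / 2) : ℕ) : ℕ∞) ≤ ENat.card X →
      ∀ (α ε δ : ℝ), 0 < α → α < 1 / 2 → 0 < ε → 0 ≤ δ → δ ≤ 1 →
        δ * Real.log (d / δ) ≤ c * (α ^ 2 * ε ^ 2 / d) →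
      ∀ (n : ℕ) (T : ShuffleTester.{u, w, z} X d),
        T.IsRobustlyPrivate α ε δ (1 / 3) → T.Solves α n →
          C * (Real.sqrt d / (α * ε)) ≤ n := by
  refine ⟨1 / 100, by norm_num, 1 / 2000, by norm_num, ?_⟩
  intro d hd X _ _ hX α ε δ hα hα1 hε hδ hδ1 hlog n T hT hS
  have hδB := delta_le_of_mul_log_le hd hδ hδ1 hlog
  have h : √(d : ℝ) ≤ 2000 * n * (α * ε) := by
    rcases lt_or_ge d 8 with hd8 | hd8
    · exact tester_bound_of_lt_eight hd hd8 hX hα hα1 hε hδ hδB T hT hS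
    · exact tester_bound_of_eight_le hd8 hX hα hα1 hε hδ hδB T hT hS
  have h1 : √(d : ℝ) / (α * ε) ≤ 2000 * n := (div_le_iff₀ (mul_pos hα hε)).2 h
  linarith
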